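/- **Setting.** Let $K$ be a field of characteristic $0$ (for instance $\mathbb R$, $\mathbb C$, or $\mathbb Q(\beta)$ with $\beta$ an indeterminate) and let $\beta\in K$ not be a negative rational number. Let $N\ge m\ge 0$ be integers. Let $z_1,\dots,z_N$ be commuting variables and $\theta_1,\dots,\theta_N$ anticommuting variables ($\theta_i\theta_j=-\theta_j\theta_i$, $\theta_i^2=0$) that commute with the $z_i$. On superpolynomials in $(z,\theta)$ over $K$ consider $$\bar{\mathcal H}=\sum_i (z_i\partial_{z_i})^2+\beta\sum_{i<j}\frac{z_i+z_j}{z_i-z_j}(z_i\partial_{z_i}-z_j\partial_{z_j})-2\beta\sum_{i<j}\frac{z_iz_j}{(z_i-z_j)^2}(1-\kappa_{ij}),$$ $$\kappa_{ij}=1-(\theta_i-\theta_j)(\partial_{\theta_i}-\partial_{\theta_j}).$$ A *superpartition* in the $m$-fermion sector is a sequence of non-negative integers $\Lambda=(\Lambda_1,\dots,\Lambda_m;\Lambda_{m+1},\dots,\Lambda_N)$ with $\Lambda_1>\dots>\Lambda_m$ and $\Lambda_{m+1}\ge\dots\ge\Lambda_N$. Let $\Lambda^*$ be its decreasing rearrangement,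 let $n_{\Lambda}(a)$ be the number of parts equal to $a$ among $\Lambda_{m+1},\dots,\Lambda_N$, and put $$\varepsilon_\Lambda=\sum_{j=1}^N\big[(\Lambda_j^*)^2+\beta(N+1-2j)\Lambda_j^*\big],\qquad m_\Lambda=\frac1{f_\Lambda}\sum_{\sigma\in S_N}\mathcal K_\sigma(\theta_1\cdots\theta_m z_1^{\Lambda_1}\cdots z_N^{\Lambda_N}),\qquad f_\Lambda=\prod_{a\ge0} n_{\Lambda}(a)!,$$ where $\mathcal K_\sigma$ substitutes $z_i\mapsto z_{\sigma(i)}$, $\theta_i\mapsto\theta_{\sigma(i)}$. For $i<j$ and $\ell\ge0$, the sequence $R^{(\ell)}_{ij}\Lambda$ is obtained from $\Lambda$ by lowering the larger of $\Lambda_i,\Lambda_j$ by $\ell$ and raising the smaller one by $\ell$. It is allowed only if: (type I) $i,j\le m$ and $\ell\le\lfloor(\Lambda_i-\Lambda_j-1)/2\rfloor$; or (type II) $i\le m<j$ and $\ell\le|\Lambda_i-\Lambda_j|-1$; or (type III) $m<i,j$ and $\ell\le\lfloor(\Lambda_i-\Lambda_j)/2\rfloor$. For a sequence $\gamma$ of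 length $N$ whose first $m$ entries are distinct, $\overline\gamma$ is the superpartition obtained by sorting the first $m$ entries and the last $N-m$ entries separately in decreasing order, and $\mathrm{sgn}(\sigma^a_\gamma)$ is the sign of the permutation that sorts the first $m$ entries. Write $\Omega\le^s\Lambda$ if $\Omega$ is obtained from $\Lambda$ by a finite (possibly empty) sequence of steps $\Gamma\mapsto\overline{R^{(\ell)}_{ij}\Gamma}$ through superpartitions, and $\Omega<^s\Lambda$ if moreover $\Omega\ne\Lambda$. If $\Omega=\overline{R^{(\ell)}_{ij}\Lambda}$ for some allowed $i,j$ and $\ell>0$, put $$v_{\Lambda\Omega}=2\beta\,\mathrm{sgn}\big(\sigma^a_{R^{(\ell)}_{ij}\Lambda}\big)\,\big(|\Lambda_i-\Lambda_j|-\delta\ell\big)\,n(a,b),$$ where $a,b$ are the $i$-th and $j$-th entries of $R^{(\ell)}_{ij}\Lambda$; $\delta=2,1,0$ for $(i,j)$ of type I, II, III; and $n(a,b)=1$ for type I, $n(a,b)=n_{\Omega}(b)$ for type II, and, for type III, $n(a,b)=n_{\Omega}(a)n_{\Omega}(b)$ if $a\ne b$ and $n(a,b)=\frac12n_{\Omega}(a)(n_{\Omega}(a)-1)$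 if $a=b$. (The value does not depend on the choice of $i,j,\ell$.) Otherwise put $v_{\Lambda\Omega}=0$. The *Jack superpolynomial* $\mathcal J_\Lambda$ is the superpolynomial $\mathcal J$ with $$\text{(i)}\ \ \bar{\mathcal H}\mathcal J=\varepsilon_\Lambda\mathcal J,\qquad\text{(ii)}\ \ \mathcal J=m_\Lambda+\sum_{\Omega^*<\Lambda^*}c_{\Lambda\Omega}\,m_\Omega\quad\text{for some } c_{\Lambda\Omega}\in K,$$ where $\Omega$ runs over superpartitions in the same sector and $<$ is the strict dominance order on partitions of the same integer; equivalently, (ii) may be replaced by the stronger condition (ii') $\mathcal J=m_\Lambda+\sum_{\Omega<^s\Lambda}c_{\Lambda\Omega}m_\Omega$. **Theorem.** Let $\Lambda$ be a superpartition in the $m$-fermion sector and let $\Lambda^{(1)},\dots,\Lambda^{(n)}=\Lambda$ be a total ordering, compatible with $\le^s$, of all the superpartitions $\le^s\Lambda$. Then $\varepsilon_{\Lambda^{(i)}}\ne\varepsilon_\Lambda$ for $i<n$, and the Jack superpolynomial $\mathcal J_\Lambda$ (the one and only superpolynomial satisfying (i) and (ii), and the one and only superpolynomial satisfying (i) and (ii'))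 is $$\mathcal J_\Lambda=c_\Lambda\begin{vmatrix} m_{\Lambda^{(1)}}&m_{\Lambda^{(2)}}&\cdots&m_{\Lambda^{(n-1)}}&m_{\Lambda^{(n)}}\\ \varepsilon_{\Lambda^{(1)}}-\varepsilon_{\Lambda^{(n)}}&v_{\Lambda^{(2)}\Lambda^{(1)}}&\cdots&v_{\Lambda^{(n-1)}\Lambda^{(1)}}&v_{\Lambda^{(n)}\Lambda^{(1)}}\\ 0&\varepsilon_{\Lambda^{(2)}}-\varepsilon_{\Lambda^{(n)}}&\cdots&v_{\Lambda^{(n-1)}\Lambda^{(2)}}&v_{\Lambda^{(n)}\Lambda^{(2)}}\\ \vdots&\ddots&\ddots&\vdots&\vdots\\ 0&\cdots&0&\varepsilon_{\Lambda^{(n-1)}}-\varepsilon_{\Lambda^{(n)}}&v_{\Lambda^{(n)}\Lambda^{(n-1)}} \end{vmatrix},\qquad c_\Lambda=(-1)^{n-1}\prod_{i=1}^{n-1}\frac1{\varepsilon_{\Lambda^{(i)}}-\varepsilon_{\Lambda^{(n)}}},$$ the determinant being expanded along its first row. -/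

import Mathlib

open scoped TensorProduct

noncomputable section

namespace JackSuper

/-! ## Superpartitions -/

/-- Superpartitions `(Λ₁,…,Λ_m ; Λ_{m+1},…,Λ_N)` in the `m`-fermion sector, where `N = m + k`:
the first `m` parts are strictly decreasing, the last `k` parts are weakly decreasing, and all
parts are non-negative integers. -/
@[ext] structure Superpartition (m k : ℕ) where
  parts : Fin (m + k) → ℕ
  strictAnti : StrictAnti fun i : Fin m => parts (Fin.castAdd k i)
  antitone : Antitone fun j : Fin k => parts (Fin.natAdd m j)

/-- The permutation that sorts a finite sequence of integers in weakly decreasing order. -/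
def sortPerm {n : ℕ} (f : Fin n → ℕ) : Equiv.Perm (Fin n) :=
  Tuple.sort fun i => OrderDual.toDual (f i)

/-- The weakly decreasing rearrangement of a finite sequence of integers. -/
def sortDesc {n : ℕ} (f : Fin n → ℕ) : Fin n → ℕ := f ∘ sortPerm f

/-- The partition `Λ*` (with `N` parts, zeros included) underlying a superpartition `Λ`. -/
def star {m k : ℕ} (Λ : Superpartition m k) : Fin (m + k) → ℕ := sortDesc Λ.parts

/-- The dominance ordering `ω ≤ μ` on partitions of the same integer. -/
def DomLE {n : ℕ} (ω μ : Fin n → ℕ) : Prop :=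
  ∑ j, ω j = ∑ j, μ j ∧ ∀ i, ∑ j ∈ Finset.Iic i, ω j ≤ ∑ j ∈ Finset.Iic i, μ j

/-- The strict dominance ordering `ω < μ`. -/
def DomLT {n : ℕ} (ω μ : Fin n → ℕ) : Prop := DomLE ω μ ∧ ω ≠ μ

/-- For a sequence `γ = (γ₁,…,γ_m ; γ_{m+1},…,γ_N)`, the sequence obtained by sorting the first
`m` entries and the last `k` entries separately in decreasing order. -/
def bar (m k : ℕ) (γ : Fin (m + k) → ℕ) : Fin (m + k) → ℕ :=
  Fin.append (sortDesc fun i : Fin m => γ (Fin.castAdd k i))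
    (sortDesc fun j : Fin k => γ (Fin.natAdd m j))

/-- The sign of the permutation that sorts the first `m` entries of `γ` in decreasing order. -/
def antiSign (m k : ℕ) (γ : Fin (m + k) → ℕ) : ℤ :=
  (Equiv.Perm.sign (sortPerm fun i : Fin m => γ (Fin.castAdd k i)) : ℤ)

/-- The value of the lowering operator `R_{ij}^{(ℓ)}` on a sequence, when it is not zero:
the larger of the entries `i`, `j` is lowered by `ℓ` and the smaller one is raised by `ℓ`. -/
def lower {N : ℕ} (γ : Fin N → ℕ) (i j : Fin N) (ℓ : ℕ) : Fin N → ℕ :=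
  if γ j < γ i then Function.update (Function.update γ i (γ i - ℓ)) j (γ j + ℓ)
  else Function.update (Function.update γ i (γ i + ℓ)) j (γ j - ℓ)

/-- The pair `(i, j)` is of type I: both positions are antisymmetric. -/
def TypeI (m : ℕ) {N : ℕ} (i j : Fin N) : Prop := (i : ℕ) < m ∧ (j : ℕ) < m

/-- The pair `(i, j)` is of type II: `i` is antisymmetric and `j` is symmetric. -/
def TypeII (m : ℕ) {N : ℕ} (i j : Fin N) : Prop := (i : ℕ) < m ∧ m ≤ (j : ℕ)

/-- The pair `(i, j)` is of type III: both positions are symmetric. -/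
def TypeIII (m : ℕ) {N : ℕ} (i j : Fin N) : Prop := m ≤ (i : ℕ) ∧ m ≤ (j : ℕ)

/-- `R_{ij}^{(ℓ)}` does not annihilate `γ`. Integer division by `2` is the floor. -/
def Admissible (m : ℕ) {N : ℕ} (γ : Fin N → ℕ) (i j : Fin N) (ℓ : ℕ) : Prop :=
  i < j ∧
    ((TypeI m i j ∧ (ℓ : ℤ) ≤ ((γ i : ℤ) - γ j - 1) / 2) ∨
     (TypeII m i j ∧ (ℓ : ℤ) ≤ |(γ i : ℤ) - γ j| - 1) ∨
     (TypeIII m i j ∧ (ℓ : ℤ) ≤ ((γ i : ℤ) - γ j) / 2))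

/-- The superpartition `Ω` is the rearrangement of `R_{ij}^{(ℓ)} Λ ≠ 0`. In particular the first
`m` entries of `R_{ij}^{(ℓ)} Λ` are pairwise distinct. -/
def Lowers {m k : ℕ} (Λ Ω : Superpartition m k) (i j : Fin (m + k)) (ℓ : ℕ) : Prop :=
  Admissible m Λ.parts i j ℓ ∧ Ω.parts = bar m k (lower Λ.parts i j ℓ)

/-- The ordering `Ω ≤ˢ Λ`: `Ω` is obtained from `Λ` by a finite, possibly empty, sequence of
lowering operators, each followed by rearrangement to a superpartition. -/
def SLE {m k : ℕ} (Ω Λ : Superpartition m k) : Prop :=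
  Relation.ReflTransGen (fun Γ Δ => ∃ i j ℓ, Lowers Γ Δ i j ℓ) Λ Ω

/-- The strict ordering `Ω <ˢ Λ`. -/
def SLT {m k : ℕ} (Ω Λ : Superpartition m k) : Prop := SLE Ω Λ ∧ Ω ≠ Λ

/-- The number `n_{λˢ}(a)` of parts equal to `a` in the symmetric part of `Λ`. -/
def symCount {m k : ℕ} (Λ : Superpartition m k) (a : ℕ) : ℕ :=
  (Finset.univ.filter fun j : Fin k => Λ.parts (Fin.natAdd m j) = a).card

/-- `f_Λ = n_{λˢ}(0)! n_{λˢ}(1)! n_{λˢ}(2)! ⋯`, the product over all values that occur in `Λ`. -/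
def fNorm {m k : ℕ} (Λ : Superpartition m k) : ℕ :=
  ∏ a ∈ Finset.univ.image Λ.parts, (symCount Λ a).factorial

section Coefficients

variable {K : Type*} [Field K] {m k : ℕ}

/-- The eigenvalue `ε_Λ = ∑_{j=1}^N ((Λ*_j)² + β (N + 1 - 2 j) Λ*_j)`. -/
def eigenvalue (β : K) (Λ : Superpartition m k) : K :=
  ∑ j : Fin (m + k), ((star Λ j : K) ^ 2 +
    β * (((m + k : ℕ) : K) + 1 - 2 * (((j : ℕ) : K) + 1)) * (star Λ j : K))

open Classical in
/-- The parameter `δ`, equal to `2`, `1`, `0` for pairs of type I, II, III. -/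
def delta (m : ℕ) {N : ℕ} (i j : Fin N) : ℕ :=
  if TypeI m i j then 2 else if TypeII m i j then 1 else 0

open Classical in
/-- The symmetry factor `n(a, b)` of the pair `(i, j)` with respect to `Ω`. -/
def symFactor (K : Type*) [Field K] (Ω : Superpartition m k) (i j : Fin (m + k)) (a b : ℕ) : K :=
  if TypeI m i j then 1
  else if TypeII m i j then (symCount Ω b : K)
  else if a ≠ b then (symCount Ω a : K) * (symCount Ω b : K)
  else 1 / 2 * (symCount Ω a : K) * ((symCount Ω a : K) - 1)

/-- The explicit coefficient attached to `Ω`, the rearrangement of `R_{ij}^{(ℓ)} Λ`. -/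
def lowerCoeff (β : K) (Λ Ω : Superpartition m k) (i j : Fin (m + k)) (ℓ : ℕ) : K :=
  if Λ.parts j < Λ.parts i then
    2 * β * (antiSign m k (lower Λ.parts i j ℓ) : K) *
      ((Λ.parts i : K) - Λ.parts j - delta m i j * ℓ) *
      symFactor K Ω i j (Λ.parts i - ℓ) (Λ.parts j + ℓ)
  else
    2 * β * (antiSign m k (lower Λ.parts i j ℓ) : K) *
      ((Λ.parts j : K) - Λ.parts i - delta m i j * ℓ) *
      symFactor K Ω i j (Λ.parts i + ℓ) (Λ.parts j - ℓ)

open Classical in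
/-- The coefficient `v_{ΛΩ}(β)`: it is `0` unless `Ω` is the rearrangement of some
`R_{ij}^{(ℓ)} Λ` with `ℓ > 0`, and then it is given by the explicit formula for any such
`(i, j, ℓ)` (its value does not depend on which one is used). -/
def vCoeff (β : K) (Λ Ω : Superpartition m k) : K :=
  if h : ∃ t : Fin (m + k) × Fin (m + k) × ℕ, 0 < t.2.2 ∧ Lowers Λ Ω t.1 t.2.1 t.2.2 then
    lowerCoeff β Λ Ω h.choose.1 h.choose.2.1 h.choose.2.2
  else 0

end Coefficients

/-! ## Superpolynomials and the Hamiltonian -/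

section Superpolynomials

variable (K : Type*) [Field K] (N : ℕ)

/-- The Grassmann algebra on the anticommuting variables `θ₁, …, θ_N`. -/
abbrev Grassmann : Type _ := ExteriorAlgebra K (Fin N → K)

/-- Superpolynomials: polynomials in the commuting variables `z₁, …, z_N` and in the anticommuting
variables `θ₁, …, θ_N`, the `z`'s commuting with the `θ`'s. -/
abbrev SuperPoly : Type _ := MvPolynomial (Fin N) K ⊗[K] Grassmann K N

/-- The same with coefficients that are rational functions of `z₁, …, z_N`. -/
abbrev SuperRat : Type _ := FractionRing (MvPolynomial (Fin N) K) ⊗[K] Grassmann K N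

variable {K N}

/-- The embedding of superpolynomials in rational superfunctions. -/
def toRat : SuperPoly K N →ₗ[K] SuperRat K N :=
  LinearMap.rTensor (Grassmann K N)
    (IsScalarTower.toAlgHom K (MvPolynomial (Fin N) K)
      (FractionRing (MvPolynomial (Fin N) K))).toLinearMap

/-- The variable `z_i` as a rational function. -/
def zvar (i : Fin N) : FractionRing (MvPolynomial (Fin N) K) :=
  algebraMap (MvPolynomial (Fin N) K) _ (MvPolynomial.X i)

/-- The anticommuting variable `θ_i`. -/
def theta (i : Fin N) : Grassmann K N := ExteriorAlgebra.ι K (Pi.single i 1)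

/-- The left derivative `∂/∂θ_i` on the Grassmann algebra. -/
def dtheta (i : Fin N) : Grassmann K N →ₗ[K] Grassmann K N :=
  CliffordAlgebra.contractLeft (Q := (0 : QuadraticForm K (Fin N → K))) (LinearMap.proj i)

/-- The operator `z_i ∂/∂z_i`. -/
def euler (i : Fin N) : SuperPoly K N →ₗ[K] SuperPoly K N :=
  LinearMap.rTensor (Grassmann K N)
    (LinearMap.mulLeft K (MvPolynomial.X i : MvPolynomial (Fin N) K) ∘ₗ
      (MvPolynomial.pderiv i).toLinearMap)

/-- The fermionic exchange operator `κ_{ij} = 1 - (θ_i - θ_j)(∂_{θ_i} - ∂_{θ_j})`. -/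
def kappa (i j : Fin N) : SuperPoly K N →ₗ[K] SuperPoly K N :=
  LinearMap.lTensor (MvPolynomial (Fin N) K)
    (LinearMap.id - LinearMap.mulLeft K (theta i - theta j) ∘ₗ (dtheta i - dtheta j))

/-- The Hamiltonian
`∑_i (z_i ∂_i)² + β ∑_{i<j} (z_i + z_j)/(z_i - z_j) (z_i ∂_i - z_j ∂_j)
  - 2 β ∑_{i<j} z_i z_j/(z_i - z_j)² (1 - κ_{ij})`. -/
def hamiltonian (β : K) (f : SuperPoly K N) : SuperRat K N :=
  ∑ i, toRat (euler i (euler i f))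
    + β • ∑ i : Fin N, ∑ j ∈ Finset.Ioi i,
        ((zvar i + zvar j) / (zvar i - zvar j) : FractionRing (MvPolynomial (Fin N) K)) •
          toRat (euler i f - euler j f)
    - (2 * β) • ∑ i : Fin N, ∑ j ∈ Finset.Ioi i,
        (zvar i * zvar j / (zvar i - zvar j) ^ 2 : FractionRing (MvPolynomial (Fin N) K)) •
          toRat (f - kappa i j f)

/-- The operator `𝒦_σ`: simultaneous substitution `z_i ↦ z_{σ(i)}`, `θ_i ↦ θ_{σ(i)}`. -/
def permAct (σ : Equiv.Perm (Fin N)) : SuperPoly K N →ₐ[K] SuperPoly K N :=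
  Algebra.TensorProduct.map (MvPolynomial.rename σ)
    (ExteriorAlgebra.map (LinearMap.funLeft K K σ.symm))

/-- The term `θ₁ ⋯ θ_m z^Λ`. -/
def leadingTerm (K : Type*) [Field K] {m k : ℕ} (Λ : Superpartition m k) : SuperPoly K (m + k) :=
  (∏ i, (MvPolynomial.X i : MvPolynomial (Fin (m + k)) K) ^ Λ.parts i) ⊗ₜ[K]
    (List.ofFn fun i : Fin m => (theta (Fin.castAdd k i) : Grassmann K (m + k))).prod

/-- The monomial symmetric superpolynomial
`m_Λ = (1/f_Λ) ∑_{σ ∈ S_N} 𝒦_σ (θ₁ ⋯ θ_m z^Λ)`. -/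
def mono (K : Type*) [Field K] {m k : ℕ} (Λ : Superpartition m k) : SuperPoly K (m + k) :=
  ((fNorm Λ : K)⁻¹) • ∑ σ : Equiv.Perm (Fin (m + k)), permAct (K := K) σ (leadingTerm K Λ)

/-- `J` is an eigenfunction of the Hamiltonian with eigenvalue `ε_Λ`, and it is equal to `m_Λ`
plus a linear combination of monomials `m_Ω` with `Ω* < Λ*` in the dominance ordering. -/
def IsJack {m k : ℕ} (β : K) (Λ : Superpartition m k) (J : SuperPoly K (m + k)) : Prop :=
  hamiltonian β J = eigenvalue β Λ • toRat J ∧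
    ∃ c : Superpartition m k →₀ K, (∀ Ω ∈ c.support, DomLT (star Ω) (star Λ)) ∧
      J = mono K Λ + c.sum fun Ω a => a • mono K Ω

/-- `J` is an eigenfunction of the Hamiltonian with eigenvalue `ε_Λ`, and it is equal to `m_Λ`
plus a linear combination of monomials `m_Ω` with `Ω <ˢ Λ`. -/
def IsStrongJack {m k : ℕ} (β : K) (Λ : Superpartition m k) (J : SuperPoly K (m + k)) : Prop :=
  hamiltonian β J = eigenvalue β Λ • toRat J ∧
    ∃ c : Superpartition m k →₀ K, (∀ Ω ∈ c.support, SLT Ω Λ) ∧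
      J = mono K Λ + c.sum fun Ω a => a • mono K Ω

end Superpolynomials

/-! ## The determinant -/

/-- The determinant of a square matrix whose first row `w` has entries in a module and whose
remaining rows `M` are scalar: its expansion along the first row. -/
def detFirstRow {K V : Type*} [Field K] [AddCommGroup V] [Module K V] {n : ℕ}
    (w : Fin (n + 1) → V) (M : Matrix (Fin n) (Fin (n + 1)) K) : V :=
  ∑ j : Fin (n + 1), ((-1) ^ (j : ℕ) * (M.submatrix id j.succAbove).det) • w j

/-- The scalar rows of the determinant attached to `Λ⁽¹⁾, …, Λ⁽ⁿ⁺¹⁾`: the entry in row `r` and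
column `c` is `0` for `c < r`, it is `ε_{Λ⁽ʳ⁾} - ε_{Λ⁽ⁿ⁺¹⁾}` for `c = r`, and it is
`v_{Λ⁽ᶜ⁾Λ⁽ʳ⁾}` for `c > r`. -/
def scalarRows {K : Type*} [Field K] {m k n : ℕ} (β : K) (L : Fin (n + 1) → Superpartition m k) :
    Matrix (Fin n) (Fin (n + 1)) K :=
  Matrix.of fun r c =>
    if c < r.castSucc then 0
    else if c = r.castSucc then eigenvalue β (L r.castSucc) - eigenvalue β (L (Fin.last n))
    else vCoeff β (L c) (L r.castSucc)

/-- The determinantal expression `c_Λ · det`, with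
`c_Λ = (-1)ⁿ ∏_{i ≤ n} 1 / (ε_{Λ⁽ⁱ⁾} - ε_{Λ⁽ⁿ⁺¹⁾})` for a list of `n + 1` superpartitions. -/
def detFormula {K : Type*} [Field K] {m k n : ℕ} (β : K) (L : Fin (n + 1) → Superpartition m k) :
    SuperPoly K (m + k) :=
  ((-1) ^ n * ∏ i : Fin n,
      1 / (eigenvalue β (L i.castSucc) - eigenvalue β (L (Fin.last n)))) •
    detFirstRow (fun i => mono K (L i)) (scalarRows β L)

/-- `Λ⁽¹⁾, …, Λ⁽ⁿ⁺¹⁾ = Λ` lists every superpartition `≤ˢ Λ` exactly once, in an order compatible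
with `≤ˢ`. -/
structure IsLinearExtension {m k n : ℕ} (Λ : Superpartition m k)
    (L : Fin (n + 1) → Superpartition m k) : Prop where
  injective : Function.Injective L
  mem_range_iff : ∀ Ω, Ω ∈ Set.range L ↔ SLE Ω Λ
  compatible : ∀ i j, SLE (L i) (L j) → i ≤ j
  last : L (Fin.last n) = Λ

end JackSuper

end

noncomputable section

namespace JackSuper

/-! ## The action of the Hamiltonian on symmetrised monomials -/

/-! ### Sums over pairs of particles and the lowering operation on sequences -/

section Pairs

variable {N : ℕ}

/-! The Hamiltonian is triangular on the monomials: `hamiltonian_mono` gives ε_Λ m_Λ plus the sum of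
v_{ΛΩ} m_Ω over the superpartitions Ω one lowering below Λ. On a function invariant under
simultaneous exchange of z and θ, κ_{ij} acts as the exchange of z_i and z_j alone, so each pair
interaction becomes a computation with ordinary monomials. There the poles cancel (`pair_identity`),
leaving z^γ with coefficient d = |γ_i - γ_j| and the lowered monomials with coefficients 2(d - ℓ), 0
< ℓ < d.

Two effects turn these terms into the stated v_{ΛΩ}. The terms ℓ and d - ℓ differ by an exchange of
two entries. After symmetrisation they combine with a minus sign for two antisymmetric positions,
with a plus sign for two symmetric ones, and not at all for mixed positions; this yields d - δℓ with
δ = 2, 0, 1. Moreover, all pairs of positions carrying the same parts contribute equally to the same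
Ω; their number, times f_Ω/f_Λ, is the factor n(a,b).

Lowering strictly decreases the sum of squares and moves down in dominance order. If Ω* < Λ*, then
ε_Λ - ε_Ω = P + βQ with integers P > 0 and Q ≥ 0, which vanishes only for a negative rational β
(`eigenvalue_ne_of_domLT`). For existence, take signed maximal minors as coefficients: their
orthogonality to each scalar row is the eigenvalue equation read off at one monomial, and the last
minor, being triangular, fixes the normalisation. For uniqueness, in a difference of two solutions
the term with the largest sum of squares cannot be reached from any other, so its eigenvalue would
have to equal ε_Λ (`eq_zero_of_hamiltonian_eq`). -/

theorem sum_Ioi_add_sum_Ioi_swap {A : Type*} [AddCommMonoid A] (F : Fin N → Fin N → A) :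
    ∑ i, ∑ j, F i j = ∑ i, ∑ j ∈ Finset.Ioi i, F i j + ∑ i, ∑ j ∈ Finset.Ioi i, F j i
      + ∑ i, F i i := by
  have h1 : ∀ i, ∑ j, F i j = ∑ j ∈ Finset.Ioi i, F i j + ∑ j ∈ Finset.Iio i, F i j + F i i := by
    intro i
    have hu : (Finset.univ : Finset (Fin N)) = (Finset.Ioi i ∪ Finset.Iio i) ∪ {i} := by
      ext j
      simp only [Finset.mem_univ, Finset.mem_union, Finset.mem_Ioi, Finset.mem_Iio,
        Finset.mem_singleton, true_iff]
      rcases lt_trichotomy i j with h | h | h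
      · exact Or.inl (Or.inl h)
      · exact Or.inr h.symm
      · exact Or.inl (Or.inr h)
    rw [hu, Finset.sum_union, Finset.sum_union, Finset.sum_singleton]
    · rw [Finset.disjoint_left]
      intro a ha hb
      rw [Finset.mem_Ioi] at ha
      rw [Finset.mem_Iio] at hb
      exact lt_asymm ha hb
    · simp
  have h2 : ∑ i, ∑ j ∈ Finset.Iio i, F i j = ∑ i, ∑ j ∈ Finset.Ioi i, F j i :=
    Finset.sum_comm' (by simp)
  rw [Finset.sum_congr rfl fun i _ => h1 i, Finset.sum_add_distrib, Finset.sum_add_distrib, h2]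

/-- A permutation need not preserve the condition i < j. By symmetry of `F`, twice this sum is the
full double sum minus the diagonal, which is invariant; characteristic 0 allows division by 2. -/
theorem sum_Ioi_comp_perm (K : Type*) [Field K] [CharZero K] {A : Type*} [AddCommGroup A]
    [Module K A] (F : Fin N → Fin N → A) (hF : ∀ i j, F i j = F j i) (σ : Equiv.Perm (Fin N)) :
    ∑ i, ∑ j ∈ Finset.Ioi i, F (σ i) (σ j) = ∑ i, ∑ j ∈ Finset.Ioi i, F i j := by
  have h1 := sum_Ioi_add_sum_Ioi_swap F
  have h2 := sum_Ioi_add_sum_Ioi_swap fun i j => F (σ i) (σ j)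
  have h3 : ∑ i, ∑ j, F (σ i) (σ j) = ∑ i, ∑ j, F i j := by
    rw [Equiv.sum_comp σ fun i => ∑ j, F i (σ j)]
    exact Finset.sum_congr rfl fun i _ => Equiv.sum_comp σ fun j => F i j
  have h4 : ∑ i, F (σ i) (σ i) = ∑ i, F i i := Equiv.sum_comp σ fun i => F i i
  simp only [fun i j => hF j i] at h1 h2
  rw [h3, h1, h4] at h2
  have h5 := add_right_cancel h2
  have : ((2 : K) • ∑ i, ∑ j ∈ Finset.Ioi i, F i j)
      = (2 : K) • ∑ i, ∑ j ∈ Finset.Ioi i, F (σ i) (σ j) := by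
    rw [two_smul, two_smul]
    have e1 : ∑ i, ∑ j ∈ Finset.Ioi i, F j i = ∑ i, ∑ j ∈ Finset.Ioi i, F i j :=
      Finset.sum_congr rfl fun i _ => Finset.sum_congr rfl fun j _ => hF j i
    have e2 : ∑ i, ∑ j ∈ Finset.Ioi i, F (σ j) (σ i) = ∑ i, ∑ j ∈ Finset.Ioi i, F (σ i) (σ j) :=
      Finset.sum_congr rfl fun i _ => Finset.sum_congr rfl fun j _ => hF _ _
    simpa only [e1, e2] using h5
  exact (smul_right_injective A (two_ne_zero : (2 : K) ≠ 0) this).symm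

/-- The distance `|γ_i - γ_j|` of two entries. -/
def gap (γ : Fin N → ℕ) (i j : Fin N) : ℕ := (γ i - γ j) + (γ j - γ i)

theorem gap_comm (γ : Fin N → ℕ) (i j : Fin N) : gap γ i j = gap γ j i := by
  unfold gap; omega

theorem gap_comp (γ : Fin N → ℕ) (σ : Fin N → Fin N) (i j : Fin N) :
    gap (γ ∘ σ) i j = gap γ (σ i) (σ j) := rfl

theorem lower_comm {γ : Fin N → ℕ} {i j : Fin N} (h : γ i ≠ γ j) (ℓ : ℕ) :
    lower γ i j ℓ = lower γ j i ℓ := by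
  have hij : i ≠ j := fun e => h (by rw [e])
  unfold lower
  rcases lt_or_gt_of_ne h with h' | h'
  · rw [if_neg (by omega), if_pos h', Function.update_comm hij]
  · rw [if_pos h', if_neg (by omega), Function.update_comm hij]

theorem lower_comp_symm (γ : Fin N → ℕ) (σ : Equiv.Perm (Fin N)) (i j : Fin N) (ℓ : ℕ) :
    lower (γ ∘ σ.symm) (σ i) (σ j) ℓ = lower γ i j ℓ ∘ σ.symm := by
  unfold lower
  simp only [Function.comp_apply, Equiv.symm_apply_apply]
  split_ifs <;> (ext a; simp [Function.update_apply, Equiv.symm_apply_eq])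

theorem comp_swap_eq_update (γ : Fin N → ℕ) {i j : Fin N} (h : i ≠ j) :
    γ ∘ Equiv.swap i j = Function.update (Function.update γ i (γ j)) j (γ i) := by
  ext a
  simp only [Function.comp_apply, Function.update_apply, Equiv.swap_apply_def]
  split_ifs <;> simp_all

end Pairs

/-! ### Cancellation of the poles in one pair interaction -/

section Polynomials

theorem sum_range_pow_closed_form {R : Type*} [CommRing R] (x y : R) (d : ℕ) :
    (x - y) * ∑ ℓ ∈ Finset.range (d + 1), x ^ (d - ℓ) * y ^ ℓ = x ^ (d + 1) - y ^ (d + 1) := by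
  have := Commute.geom_sum₂_mul (Commute.all y x) (d + 1)
  have h : ∑ i ∈ Finset.range (d + 1), y ^ i * x ^ (d + 1 - 1 - i)
      = ∑ ℓ ∈ Finset.range (d + 1), x ^ (d - ℓ) * y ^ ℓ :=
    Finset.sum_congr rfl fun i _ => by rw [mul_comm, Nat.add_sub_cancel]
  rw [h] at this
  linear_combination -this

/-- Passing from d to d + 1 multiplies the sum by x and adds x times a geometric sum, so induction
applies. -/
theorem weighted_sum_closed_form {R : Type*} [CommRing R] (x y : R) (d : ℕ) :
    (x - y) ^ 2 * ∑ ℓ ∈ Finset.range d, ((d : R) - ℓ) * (x ^ (d - ℓ) * y ^ ℓ)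
      = d * x ^ (d + 1) * (x - y) - x * y * (x ^ d - y ^ d) := by
  induction d with
  | zero => simp
  | succ d ih =>
    have h1 : ∑ ℓ ∈ Finset.range (d + 1), (((d + 1 : ℕ) : R) - ℓ) * (x ^ (d + 1 - ℓ) * y ^ ℓ)
        = x * ∑ ℓ ∈ Finset.range d, ((d : R) - ℓ) * (x ^ (d - ℓ) * y ^ ℓ)
          + x * ∑ ℓ ∈ Finset.range (d + 1), x ^ (d - ℓ) * y ^ ℓ := by
      have h2 : ∑ ℓ ∈ Finset.range d, ((d : R) - ℓ) * (x ^ (d - ℓ) * y ^ ℓ)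
          = ∑ ℓ ∈ Finset.range (d + 1), ((d : R) - ℓ) * (x ^ (d - ℓ) * y ^ ℓ) := by
        rw [Finset.sum_range_succ]; simp
      rw [h2, Finset.mul_sum, Finset.mul_sum, ← Finset.sum_add_distrib]
      refine Finset.sum_congr rfl fun ℓ hℓ => ?_
      have : d + 1 - ℓ = (d - ℓ) + 1 := by have := Finset.mem_range.1 hℓ; omega
      rw [this]; push_cast; ring
    rw [h1]
    push_cast
    linear_combination x * ih + x * (x - y) * sum_range_pow_closed_form x y d

/-- This divisibility by (x - y)² cancels the double pole of the interaction. The ℓ = 0 term enters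
twice from the weighted sum and loses one copy to the first term on the left, hence its coefficient
d instead of 2d. -/
theorem pair_identity {R : Type*} [CommRing R] (x y : R) (d : ℕ) :
    (x ^ 2 - y ^ 2) * (d * x ^ d) - 2 * (x * y) * (x ^ d - y ^ d)
      = (x - y) ^ 2 * (d * x ^ d
        + 2 * ∑ ℓ ∈ Finset.Ioo 0 d, ((d : R) - ℓ) * (x ^ (d - ℓ) * y ^ ℓ)) := by
  rcases Nat.eq_zero_or_pos d with rfl | hd
  · simp
  have h : ∑ ℓ ∈ Finset.range d, ((d : R) - ℓ) * (x ^ (d - ℓ) * y ^ ℓ)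
      = d * x ^ d + ∑ ℓ ∈ Finset.Ioo 0 d, ((d : R) - ℓ) * (x ^ (d - ℓ) * y ^ ℓ) := by
    have e : Finset.range d = insert 0 (Finset.Ioo 0 d) := by
      ext a; simp only [Finset.mem_range, Finset.mem_insert, Finset.mem_Ioo]; omega
    rw [e, Finset.sum_insert (by simp)]
    simp
  have h2 := weighted_sum_closed_form x y d
  rw [h] at h2
  linear_combination -2 * h2

variable {K : Type*} [Field K] {N : ℕ}

/-- The monomial `z^γ`. -/
def zmon (K : Type*) [Field K] {N : ℕ} (γ : Fin N → ℕ) : MvPolynomial (Fin N) K :=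
  ∏ i, MvPolynomial.X i ^ γ i

theorem zmon_eq_monomial (γ : Fin N → ℕ) :
    zmon K γ = MvPolynomial.monomial (Finsupp.equivFunOnFinite.symm γ) 1 := by
  rw [MvPolynomial.monomial_eq, Finsupp.prod_fintype _ _ (by simp)]
  simp [zmon]

theorem rename_zmon (σ : Equiv.Perm (Fin N)) (γ : Fin N → ℕ) :
    MvPolynomial.rename σ (zmon K γ) = zmon K (γ ∘ σ.symm) := by
  simp only [zmon, map_prod, map_pow, MvPolynomial.rename_X, Function.comp_apply]
  rw [← Equiv.prod_comp σ fun i => (MvPolynomial.X i : MvPolynomial (Fin N) K) ^ γ (σ.symm i)]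
  simp

theorem X_mul_pderiv_zmon (γ : Fin N → ℕ) (i : Fin N) :
    MvPolynomial.X i * MvPolynomial.pderiv i (zmon K γ) = (γ i : K) • zmon K γ := by
  rw [zmon_eq_monomial, MvPolynomial.X_mul_pderiv_monomial, Nat.cast_smul_eq_nsmul]
  rfl

theorem zmon_update_update (γ : Fin N → ℕ) {i j : Fin N} (h : i ≠ j) (a b : ℕ) :
    zmon K (Function.update (Function.update γ i a) j b)
      = (∏ l ∈ (Finset.univ.erase i).erase j, (MvPolynomial.X l : MvPolynomial (Fin N) K) ^ γ l)
        * (MvPolynomial.X i ^ a * MvPolynomial.X j ^ b) := by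
  unfold zmon
  rw [← Finset.mul_prod_erase _ _ (Finset.mem_univ i),
    ← Finset.mul_prod_erase _ _ (Finset.mem_erase.2 ⟨h.symm, Finset.mem_univ j⟩)]
  simp only [Function.update_self, Function.update_of_ne h]
  rw [Finset.prod_congr rfl (g := fun l => (MvPolynomial.X l : MvPolynomial (Fin N) K) ^ γ l)]
  · ring
  · intro l hl
    simp only [Finset.mem_erase] at hl
    rw [Function.update_of_ne hl.1, Function.update_of_ne hl.2.1]

/-- The terms produced from `z^γ` by the pair interaction of particles `i` and `j`. -/
def pairPoly (K : Type*) [Field K] {N : ℕ} (γ : Fin N → ℕ) (i j : Fin N) :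
    MvPolynomial (Fin N) K :=
  (gap γ i j : K) • zmon K γ
    + (2 : K) • ∑ ℓ ∈ Finset.Ioo 0 (gap γ i j), ((gap γ i j : K) - ℓ) • zmon K (lower γ i j ℓ)

theorem pairPoly_comm (γ : Fin N → ℕ) (i j : Fin N) : pairPoly K γ i j = pairPoly K γ j i := by
  unfold pairPoly
  rw [gap_comm γ j i]
  congr 2
  refine Finset.sum_congr rfl fun ℓ hℓ => ?_
  rw [lower_comm]
  intro e
  simp [gap, e] at hℓ

theorem rename_pairPoly (σ : Equiv.Perm (Fin N)) (γ : Fin N → ℕ) (i j : Fin N) :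
    MvPolynomial.rename σ (pairPoly K γ i j) = pairPoly K (γ ∘ σ.symm) (σ i) (σ j) := by
  simp only [pairPoly, map_add, map_smul, map_sum, rename_zmon, gap_comp, Equiv.symm_apply_apply,
    lower_comp_symm]

/-- All the monomials share the other variables and the factor (z_i z_j)^{γ_j}; removing these
leaves `pair_identity` with d = γ_i - γ_j. -/
theorem pairPoly_identity_of_le (γ : Fin N → ℕ) {i j : Fin N} (h : i ≠ j) (hle : γ j ≤ γ i) :
    (MvPolynomial.X i ^ 2 - MvPolynomial.X j ^ 2) * (((γ i : K) - γ j) • zmon K γ)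
      - 2 * (MvPolynomial.X i * MvPolynomial.X j) * (zmon K γ - zmon K (γ ∘ Equiv.swap i j))
      = (MvPolynomial.X i - MvPolynomial.X j) ^ 2 * pairPoly K γ i j := by
  obtain ⟨d, hd⟩ := Nat.exists_eq_add_of_le hle
  have hgap : gap γ i j = d := by unfold gap; omega
  have h0 : zmon K γ = _ :=
    (congrArg (zmon K) (by simp)).trans (zmon_update_update (K := K) γ h (γ i) (γ j))
  have hl : ∀ ℓ ∈ Finset.Ioo 0 d, ((d : K) - ℓ) • zmon K (lower γ i j ℓ)
      = ((∏ l ∈ (Finset.univ.erase i).erase j, (MvPolynomial.X l : MvPolynomial (Fin N) K) ^ γ l)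
        * (MvPolynomial.X i * MvPolynomial.X j) ^ γ j) * (((d : MvPolynomial (Fin N) K) - (ℓ : MvPolynomial (Fin N) K)) *
          (MvPolynomial.X i ^ (d - ℓ) * MvPolynomial.X j ^ ℓ)) := by
    intro ℓ hℓ
    rw [Finset.mem_Ioo] at hℓ
    rw [show lower γ i j ℓ = Function.update (Function.update γ i (γ i - ℓ)) j (γ j + ℓ) from
      if_pos (by omega), zmon_update_update γ h, MvPolynomial.smul_eq_C_mul,
      show γ i - ℓ = γ j + (d - ℓ) by omega]
    simp only [map_sub, map_natCast]
    ring
  rw [pairPoly, hgap, Finset.sum_congr rfl hl, ← Finset.mul_sum, comp_swap_eq_update γ h,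
    zmon_update_update γ h, h0, show ((γ i : K) - γ j) = (d : K) by rw [hd]; push_cast; ring,
    MvPolynomial.smul_eq_C_mul, MvPolynomial.smul_eq_C_mul, hd,
    map_natCast, map_ofNat]
  linear_combination ((∏ l ∈ (Finset.univ.erase i).erase j,
      (MvPolynomial.X l : MvPolynomial (Fin N) K) ^ γ l)
        * (MvPolynomial.X i * MvPolynomial.X j) ^ γ j)
    * pair_identity (MvPolynomial.X i : MvPolynomial (Fin N) K) (MvPolynomial.X j) d

theorem pairPoly_identity (γ : Fin N → ℕ) {i j : Fin N} (h : i ≠ j) :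
    (MvPolynomial.X i ^ 2 - MvPolynomial.X j ^ 2) * (((γ i : K) - γ j) • zmon K γ)
      - 2 * (MvPolynomial.X i * MvPolynomial.X j) * (zmon K γ - zmon K (γ ∘ Equiv.swap i j))
      = (MvPolynomial.X i - MvPolynomial.X j) ^ 2 * pairPoly K γ i j := by
  rcases le_total (γ j) (γ i) with hle | hle
  · exact pairPoly_identity_of_le γ h hle
  · have := pairPoly_identity_of_le (K := K) γ h.symm hle
    rw [pairPoly_comm, Equiv.swap_comm, ← neg_sub (γ i : K), neg_smul] at this
    linear_combination this

end Polynomials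

/-! ### Fermionic exchange and the Hamiltonian on symmetrised monomials -/

section Super

variable {K : Type*} [Field K] {N : ℕ}

theorem toRat_tmul (p : MvPolynomial (Fin N) K) (w : Grassmann K N) :
    toRat (p ⊗ₜ[K] w) = (algebraMap _ (FractionRing (MvPolynomial (Fin N) K)) p) ⊗ₜ[K] w := rfl

/-- Tensoring over a field preserves injectivity. This lets eigenvalue equations be compared
coefficient by coefficient in superpolynomials. -/
theorem toRat_injective : Function.Injective (toRat (K := K) (N := N)) := by
  have : Module.Free K (Grassmann K N) := Module.Free.of_divisionRing _ _
  exact Module.Flat.rTensor_preserves_injective_linearMap _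
    (IsFractionRing.injective (MvPolynomial (Fin N) K) (FractionRing (MvPolynomial (Fin N) K)))

theorem permAct_tmul (σ : Equiv.Perm (Fin N)) (p : MvPolynomial (Fin N) K) (w : Grassmann K N) :
    permAct (K := K) σ (p ⊗ₜ[K] w) = MvPolynomial.rename σ p ⊗ₜ[K]
      ExteriorAlgebra.map (LinearMap.funLeft K K σ.symm) w := rfl

theorem permAct_mul (σ τ : Equiv.Perm (Fin N)) (f : SuperPoly K N) :
    permAct (K := K) (σ * τ) f = permAct (K := K) σ (permAct (K := K) τ f) := by
  induction f using TensorProduct.induction_on with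
  | zero => simp
  | add x y hx hy => simp [hx, hy]
  | tmul p w =>
    simp only [permAct_tmul, MvPolynomial.rename_rename, Equiv.Perm.coe_mul]
    rw [← AlgHom.comp_apply, ExteriorAlgebra.map_comp_map]
    rfl

theorem euler_zmon_tmul (γ : Fin N → ℕ) (w : Grassmann K N) (i : Fin N) :
    euler i (zmon K γ ⊗ₜ[K] w) = (γ i : K) • (zmon K γ ⊗ₜ[K] w) := by
  rw [euler, LinearMap.rTensor_tmul, TensorProduct.smul_tmul', ← X_mul_pderiv_zmon]
  rfl

/-- Induct on left multiplication by a vector: v² = 0 removes the term quadratic in v, and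
anticommutation matches the rest. Hence the formula holds for every rank-one perturbation of the
identity, not only for reflections. -/
theorem map_reflection (v : Fin N → K) (d : Module.Dual K (Fin N → K))
    (r : (Fin N → K) →ₗ[K] (Fin N → K)) (hr : ∀ x, r x = x - d x • v) (w : Grassmann K N) :
    ExteriorAlgebra.map r w = w - ExteriorAlgebra.ι K v *
      CliffordAlgebra.contractLeft (Q := (0 : QuadraticForm K (Fin N → K))) d w := by
  induction w using CliffordAlgebra.left_induction with
  | algebraMap c =>
    rw [CliffordAlgebra.contractLeft_algebraMap, mul_zero, sub_zero]
    exact AlgHom.commutes _ c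
  | add x y hx hy => rw [map_add, map_add, hx, hy]; noncomm_ring
  | ι_mul b x hb =>
    rw [map_mul, hb, CliffordAlgebra.contractLeft_ι_mul]
    have h1 : ExteriorAlgebra.map r (CliffordAlgebra.ι 0 x)
        = ExteriorAlgebra.ι K x - d x • ExteriorAlgebra.ι K v := by
      rw [← map_smul, ← map_sub, ← hr]
      exact ExteriorAlgebra.map_apply_ι r x
    have h2 : ExteriorAlgebra.ι K v * ExteriorAlgebra.ι K v = 0 := ExteriorAlgebra.ι_sq_zero v
    have h3 : ExteriorAlgebra.ι K x * ExteriorAlgebra.ι K v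
        = - (ExteriorAlgebra.ι K v * ExteriorAlgebra.ι K x) :=
      eq_neg_of_add_eq_zero_left (ExteriorAlgebra.ι_add_mul_swap x v)
    rw [h1]
    change _ = ExteriorAlgebra.ι K x * b - ExteriorAlgebra.ι K v *
      (d x • b - ExteriorAlgebra.ι K x * _)
    generalize (CliffordAlgebra.contractLeft (Q := (0 : QuadraticForm K (Fin N → K))) d) b = c
    change (ExteriorAlgebra.ι K x - d x • ExteriorAlgebra.ι K v)
      * (b - ExteriorAlgebra.ι K v * c) = _
    rw [sub_mul, mul_sub, mul_sub, mul_sub, ← mul_assoc, h3, smul_mul_assoc, smul_mul_assoc,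
      ← mul_assoc, h2, mul_smul_comm, ← mul_assoc]
    simp only [zero_mul, smul_zero, sub_zero, neg_mul]
    abel

/-- Exchanging coordinates i and j subtracts (x_i - x_j)(e_i - e_j) from x, so `map_reflection`
applies. -/
theorem kappa_tmul (i j : Fin N) (p : MvPolynomial (Fin N) K) (w : Grassmann K N) :
    kappa i j (p ⊗ₜ[K] w) = p ⊗ₜ[K]
      ExteriorAlgebra.map (LinearMap.funLeft K K (Equiv.swap i j)) w := by
  rw [kappa, LinearMap.lTensor_tmul]
  congr 1
  rw [map_reflection (Pi.single i 1 - Pi.single j 1) 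
    ((LinearMap.proj i : Module.Dual K (Fin N → K)) - LinearMap.proj j)]
  · simp only [theta, dtheta, map_sub]
    rfl
  · intro x
    ext a
    simp only [LinearMap.funLeft_apply, Pi.sub_apply, Pi.smul_apply, LinearMap.sub_apply,
      LinearMap.proj_apply, Pi.single_apply, smul_eq_mul, Equiv.swap_apply_def]
    split_ifs <;> simp_all

/-- Applying the fermionic exchange after the joint exchange undoes the permutation of the θ's and
leaves that of the z's. -/
theorem kappa_eq_of_permAct_swap_eq {i j : Fin N} {f : SuperPoly K N}
    (h : permAct (K := K) (Equiv.swap i j) f = f) :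
    kappa i j f = LinearMap.rTensor (Grassmann K N)
      (MvPolynomial.rename (Equiv.swap i j)).toLinearMap f := by
  have key : ∀ g : SuperPoly K N, kappa i j (permAct (K := K) (Equiv.swap i j) g)
      = LinearMap.rTensor (Grassmann K N)
        (MvPolynomial.rename (Equiv.swap i j)).toLinearMap g := by
    intro g
    induction g using TensorProduct.induction_on with
    | zero => simp
    | add x y hx hy => simp only [map_add, hx, hy]
    | tmul p w =>
      rw [permAct_tmul, kappa_tmul, LinearMap.rTensor_tmul, ← AlgHom.comp_apply,
        ExteriorAlgebra.map_comp_map, Equiv.symm_swap]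
      congr 1
      have : (LinearMap.funLeft K K (Equiv.swap i j) ∘ₗ LinearMap.funLeft K K (Equiv.swap i j))
          = LinearMap.id := by
        ext x a
        simp [LinearMap.funLeft_apply]
      rw [this, ExteriorAlgebra.map_id]
      rfl
  rw [← key f, h]

theorem zvar_sub_ne_zero {i j : Fin N} (h : i ≠ j) :
    (zvar i - zvar j : FractionRing (MvPolynomial (Fin N) K)) ≠ 0 := by
  rw [sub_ne_zero]
  intro e
  exact h (MvPolynomial.X_injective (R := K)
    (IsFractionRing.injective (MvPolynomial (Fin N) K) _ e))

theorem smul_sub_smul_rat (a b : K) (x : SuperRat K N) : a • x - b • x = (a - b) • x :=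
  (sub_smul a b x).symm

theorem tmul_sub_tmul_rat (p q : FractionRing (MvPolynomial (Fin N) K)) (w : Grassmann K N) :
    p ⊗ₜ[K] w - q ⊗ₜ[K] w = (p - q) ⊗ₜ[K] w :=
  (TensorProduct.sub_tmul p q w).symm

theorem pair_interaction_zmon (γ : Fin N → ℕ) {i j : Fin N} (h : i ≠ j) (w : Grassmann K N) :
    ((zvar i + zvar j) / (zvar i - zvar j) : FractionRing (MvPolynomial (Fin N) K)) •
        toRat (euler i (zmon K γ ⊗ₜ[K] w) - euler j (zmon K γ ⊗ₜ[K] w))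
      - (2 : K) • ((zvar i * zvar j / (zvar i - zvar j) ^ 2 :
        FractionRing (MvPolynomial (Fin N) K)) •
          toRat (zmon K γ ⊗ₜ[K] w - zmon K (γ ∘ Equiv.swap i j) ⊗ₜ[K] w))
      = toRat (pairPoly K γ i j ⊗ₜ[K] w) := by
  rw [euler_zmon_tmul, euler_zmon_tmul, map_sub, map_sub, map_smul, map_smul, smul_sub_smul_rat,
    ← map_smul, TensorProduct.smul_tmul', toRat_tmul, toRat_tmul, toRat_tmul, toRat_tmul,
    tmul_sub_tmul_rat, TensorProduct.smul_tmul', TensorProduct.smul_tmul',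
    TensorProduct.smul_tmul', tmul_sub_tmul_rat]
  congr 1
  have hne := zvar_sub_ne_zero (K := K) h
  have id1 := congrArg (algebraMap (MvPolynomial (Fin N) K)
    (FractionRing (MvPolynomial (Fin N) K))) (pairPoly_identity (K := K) γ h)
  simp only [map_sub, map_mul, map_pow, map_ofNat] at id1
  change (zvar i ^ 2 - zvar j ^ 2) * _ - 2 * (zvar i * zvar j) * _
    = (zvar i - zvar j) ^ 2 * _ at id1
  rw [two_smul, smul_eq_mul, smul_eq_mul]
  field_simp
  linear_combination id1

/-- The sum over the symmetric group of the images of `z^γ ⊗ w`. -/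
def symSum (w : Grassmann K N) (γ : Fin N → ℕ) : SuperPoly K N :=
  ∑ σ : Equiv.Perm (Fin N), permAct (K := K) σ (zmon K γ ⊗ₜ[K] w)

theorem permAct_symSum (w : Grassmann K N) (γ : Fin N → ℕ) (τ : Equiv.Perm (Fin N)) :
    permAct (K := K) τ (symSum w γ) = symSum w γ := by
  simp only [symSum, map_sum, ← permAct_mul]
  exact Equiv.sum_comp (Equiv.mulLeft τ) fun σ => permAct (K := K) σ (zmon K γ ⊗ₜ[K] w)

theorem symSum_perm (w : Grassmann K N) (γ : Fin N → ℕ) (τ : Equiv.Perm (Fin N)) :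
    symSum (ExteriorAlgebra.map (LinearMap.funLeft K K τ.symm) w) (γ ∘ τ.symm)
      = symSum w γ := by
  simp only [symSum]
  rw [← Equiv.sum_comp (Equiv.mulRight τ) fun σ => permAct (K := K) σ (zmon K γ ⊗ₜ[K] w)]
  refine Finset.sum_congr rfl fun σ _ => ?_
  rw [Equiv.coe_mulRight, permAct_mul, permAct_tmul τ, rename_zmon]

theorem hamiltonian_eq (β : K) (f : SuperPoly K N) :
    hamiltonian β f = ∑ i, toRat (euler i (euler i f))
      + β • ∑ i : Fin N, ∑ j ∈ Finset.Ioi i,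
        (((zvar i + zvar j) / (zvar i - zvar j) : FractionRing (MvPolynomial (Fin N) K)) •
          toRat (euler i f - euler j f)
        - (2 : K) • ((zvar i * zvar j / (zvar i - zvar j) ^ 2 :
          FractionRing (MvPolynomial (Fin N) K)) • toRat (f - kappa i j f))) := by
  simp only [hamiltonian, Finset.sum_sub_distrib, smul_sub, ← Finset.smul_sum]
  rw [mul_comm, mul_smul, add_sub_assoc, smul_comm]

theorem hamiltonian_add (β : K) (f g : SuperPoly K N) :
    hamiltonian β (f + g) = hamiltonian β f + hamiltonian β g := by
  simp only [hamiltonian, map_add, add_sub_add_comm, smul_add, Finset.sum_add_distrib]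
  abel

theorem hamiltonian_smul (β c : K) (f : SuperPoly K N) :
    hamiltonian β (c • f) = c • hamiltonian β f := by
  simp only [hamiltonian, map_smul, map_sub, smul_sub, smul_add, Finset.smul_sum, smul_comm c]

/-- The Hamiltonian as a linear map. -/
def hamiltonianLin (β : K) : SuperPoly K N →ₗ[K] SuperRat K N where
  toFun := hamiltonian β
  map_add' := hamiltonian_add β
  map_smul' := hamiltonian_smul β

/-- The coefficient `∑_i γ_i² + β ∑_{i<j} |γ_i - γ_j|`. -/
def diagCoeff (β : K) (γ : Fin N → ℕ) : K :=
  ∑ i, (γ i : K) ^ 2 + β * ∑ i : Fin N, ∑ j ∈ Finset.Ioi i, (gap γ i j : K)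

theorem hamiltonian_symSum [CharZero K] (β : K) (w : Grassmann K N) (γ : Fin N → ℕ) :
    hamiltonian β (symSum w γ) = toRat (diagCoeff β γ • symSum w γ
      + (2 * β) • ∑ i : Fin N, ∑ j ∈ Finset.Ioi i, ∑ ℓ ∈ Finset.Ioo 0 (gap γ i j),
        ((gap γ i j : K) - ℓ) • symSum w (lower γ i j ℓ)) := by
  have hsum : symSum w γ = ∑ σ : Equiv.Perm (Fin N), zmon K (γ ∘ σ.symm) ⊗ₜ[K]
      ExteriorAlgebra.map (LinearMap.funLeft K K σ.symm) w := by
    simp only [symSum, permAct_tmul, rename_zmon]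
  have h1 : ∑ i, toRat (euler i (euler i (symSum w γ)))
      = toRat ((∑ i, (γ i : K) ^ 2) • symSum w γ) := by
    rw [hsum, ← map_sum]
    congr 1
    simp only [map_sum, euler_zmon_tmul, map_smul, smul_smul, Function.comp_apply, ← pow_two]
    rw [Finset.sum_comm, Finset.smul_sum]
    refine Finset.sum_congr rfl fun σ _ => ?_
    rw [← Finset.sum_smul, Equiv.sum_comp σ.symm fun i => (γ i : K) ^ 2]
  have h2 : ∀ i : Fin N, ∀ j ∈ Finset.Ioi i,
      (((zvar i + zvar j) / (zvar i - zvar j) : FractionRing (MvPolynomial (Fin N) K)) •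
          toRat (euler i (symSum w γ) - euler j (symSum w γ))
        - (2 : K) • ((zvar i * zvar j / (zvar i - zvar j) ^ 2 :
          FractionRing (MvPolynomial (Fin N) K)) •
            toRat (symSum w γ - kappa i j (symSum w γ))))
      = toRat (∑ σ : Equiv.Perm (Fin N), pairPoly K (γ ∘ σ.symm) i j ⊗ₜ[K]
          ExteriorAlgebra.map (LinearMap.funLeft K K σ.symm) w) := by
    intro i j hj
    have hij : i ≠ j := (Finset.mem_Ioi.1 hj).ne
    rw [kappa_eq_of_permAct_swap_eq (permAct_symSum w γ _), hsum]
    simp only [map_sum, LinearMap.rTensor_tmul, AlgHom.toLinearMap_apply, rename_zmon,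
      Equiv.symm_swap, ← Finset.sum_sub_distrib, Finset.smul_sum]
    exact Finset.sum_congr rfl fun σ _ => pair_interaction_zmon _ hij _
  -- For each σ, relabelling the pairs by σ replaces the gaps of the permuted exponents by those of
  -- γ itself. The inner sums then become symmetrised monomials.
  have h3 : ∑ i : Fin N, ∑ j ∈ Finset.Ioi i,
      (∑ σ : Equiv.Perm (Fin N), pairPoly K (γ ∘ σ.symm) i j ⊗ₜ[K]
          ExteriorAlgebra.map (LinearMap.funLeft K K σ.symm) w)
      = ∑ i : Fin N, ∑ j ∈ Finset.Ioi i, ((gap γ i j : K) • symSum w γ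
        + (2 : K) • ∑ ℓ ∈ Finset.Ioo 0 (gap γ i j),
          ((gap γ i j : K) - ℓ) • symSum w (lower γ i j ℓ)) := by
    have e1 : ∀ i : Fin N, ∀ j ∈ Finset.Ioi i, ((gap γ i j : K) • symSum w γ
        + (2 : K) • ∑ ℓ ∈ Finset.Ioo 0 (gap γ i j),
          ((gap γ i j : K) - ℓ) • symSum w (lower γ i j ℓ))
        = ∑ σ : Equiv.Perm (Fin N), permAct (K := K) σ (pairPoly K γ i j ⊗ₜ[K] w) := by
      intro i j _
      simp only [symSum, pairPoly, TensorProduct.add_tmul, TensorProduct.sum_tmul, map_add,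
        ← TensorProduct.smul_tmul', map_smul, map_sum, Finset.sum_add_distrib, Finset.smul_sum]
      congr 1
      exact Finset.sum_comm
    rw [Finset.sum_congr rfl fun i _ => Finset.sum_congr rfl (e1 i)]
    simp only [permAct_tmul, rename_pairPoly]
    have e2 : ∀ F : Fin N → Fin N → Equiv.Perm (Fin N) → SuperPoly K N,
        ∑ i : Fin N, ∑ j ∈ Finset.Ioi i, ∑ σ, F i j σ
          = ∑ σ, ∑ i : Fin N, ∑ j ∈ Finset.Ioi i, F i j σ := by
      intro F
      rw [Finset.sum_comm]
      exact Finset.sum_congr rfl fun i _ => Finset.sum_comm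
    rw [e2, e2]
    refine Finset.sum_congr rfl fun σ _ => ?_
    exact (sum_Ioi_comp_perm K (fun i j => pairPoly K (γ ∘ σ.symm) i j ⊗ₜ[K]
      ExteriorAlgebra.map (LinearMap.funLeft K K σ.symm) w)
      (fun i j => by rw [pairPoly_comm]) σ).symm
  rw [hamiltonian_eq, h1, Finset.sum_congr rfl fun i _ => Finset.sum_congr rfl (h2 i)]
  simp only [← map_sum, ← map_smul, ← map_add]
  rw [h3]
  congr 1
  simp only [diagCoeff, Finset.sum_add_distrib, ← Finset.sum_smul, ← Finset.smul_sum, smul_add,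
    add_smul, smul_smul]
  rw [mul_comm β 2, add_assoc]

end Super

/-! ## Sorting and rearrangement classes -/

section Sorting

variable {n : ℕ}

/-- The multiset of values of a finite sequence. -/
def values (f : Fin n → ℕ) : Multiset ℕ := Finset.univ.val.map f

theorem values_comp_perm (f : Fin n → ℕ) (σ : Equiv.Perm (Fin n)) :
    values (f ∘ σ) = values f := by
  unfold values
  rw [← Multiset.map_map, Multiset.map_univ_val_equiv]

/-- Writing a replacement with one extra element on each side avoids truncated multiset subtraction;
later exchange statements keep this form. -/
theorem cons_values_update (f : Fin n → ℕ) (i : Fin n) (a : ℕ) :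
    f i ::ₘ values (Function.update f i a) = a ::ₘ values f := by
  have h : (Finset.univ : Finset (Fin n)).val = i ::ₘ (Finset.univ.erase i).val := by
    rw [Finset.erase_val, Multiset.cons_erase (Finset.mem_univ i)]
  unfold values
  rw [h, Multiset.map_cons, Multiset.map_cons, Function.update_self, Multiset.cons_swap]
  congr 2
  refine Multiset.map_congr rfl fun l hl => Function.update_of_ne ?_ _ _
  exact (Finset.mem_erase.1 (Finset.mem_def.2 hl)).1

theorem count_values (f : Fin n → ℕ) (a : ℕ) :
    (values f).count a = (Finset.univ.filter fun i => f i = a).card := by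
  rw [values, Multiset.count_map]
  simp only [eq_comm (a := a)]
  rfl

theorem sum_values {A : Type*} [AddCommMonoid A] (f : Fin n → ℕ) (g : ℕ → A) :
    ((values f).map g).sum = ∑ i, g (f i) := by
  rw [values, Multiset.map_map]; rfl

theorem eq_of_antitone_of_values_eq {f g : Fin n → ℕ} (hf : Antitone f) (hg : Antitone g)
    (h : values f = values g) : f = g := by
  have e : ∀ f : Fin n → ℕ, values f = (List.ofFn f : Multiset ℕ) := fun f => by
    simp [values, Fin.univ_val_map]
  rw [e, e, Multiset.coe_eq_coe] at h
  refine List.ofFn_injective (List.Perm.eq_of_pairwise (le := fun a b => b ≤ a)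
    (fun a b _ _ h1 h2 => le_antisymm h2 h1) ?_ ?_ h)
  · exact List.pairwise_ofFn.2 fun i j hij => hf hij.le
  · exact List.pairwise_ofFn.2 fun i j hij => hg hij.le

theorem sortDesc_antitone (f : Fin n → ℕ) : Antitone (sortDesc f) := fun _ _ h =>
  Tuple.monotone_sort (fun i => OrderDual.toDual (f i)) h

theorem values_sortDesc (f : Fin n → ℕ) : values (sortDesc f) = values f :=
  values_comp_perm f _

theorem eq_sortDesc_iff {f g : Fin n → ℕ} (hf : Antitone f) :
    f = sortDesc g ↔ values f = values g := by
  constructor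
  · intro h; rw [h, values_sortDesc]
  · intro h
    exact eq_of_antitone_of_values_eq hf (sortDesc_antitone g) (h.trans (values_sortDesc g).symm)

end Sorting

/-! ### Superpartitions as pairs of multisets -/

section Blocks

variable {m k : ℕ}

/-- The first `m` entries of a sequence. -/
def antiBlock (m k : ℕ) (γ : Fin (m + k) → ℕ) : Fin m → ℕ := fun i => γ (Fin.castAdd k i)

/-- The last `k` entries of a sequence. -/
def symBlock (m k : ℕ) (γ : Fin (m + k) → ℕ) : Fin k → ℕ := fun i => γ (Fin.natAdd m i)

theorem antiBlock_bar (γ : Fin (m + k) → ℕ) :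
    antiBlock m k (bar m k γ) = sortDesc (antiBlock m k γ) := by
  ext i; simp [antiBlock, bar]; rfl

theorem symBlock_bar (γ : Fin (m + k) → ℕ) :
    symBlock m k (bar m k γ) = sortDesc (symBlock m k γ) := by
  ext i; simp [symBlock, bar]; rfl

theorem ext_blocks {γ δ : Fin (m + k) → ℕ} (h1 : antiBlock m k γ = antiBlock m k δ)
    (h2 : symBlock m k γ = symBlock m k δ) : γ = δ := by
  ext i
  induction i using Fin.addCases with
  | left i => exact congrFun h1 i
  | right i => exact congrFun h2 i

/-- A weakly decreasing sequence is determined by its multiset of values, so rearrangement classes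
become equalities of two multisets, one for each block. -/
theorem parts_eq_bar_iff (Ω : Superpartition m k) (γ : Fin (m + k) → ℕ) :
    Ω.parts = bar m k γ ↔ values (antiBlock m k Ω.parts) = values (antiBlock m k γ) ∧
      values (symBlock m k Ω.parts) = values (symBlock m k γ) := by
  rw [← eq_sortDesc_iff (f := antiBlock m k Ω.parts) Ω.strictAnti.antitone,
    ← eq_sortDesc_iff (f := symBlock m k Ω.parts) Ω.antitone, ← antiBlock_bar, ← symBlock_bar]
  exact ⟨fun h => by rw [h]; exact ⟨rfl, rfl⟩, fun h => ext_blocks h.1 h.2⟩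

theorem superpartition_eq_of_values {Ω Ω' : Superpartition m k}
    (h1 : values (antiBlock m k Ω.parts) = values (antiBlock m k Ω'.parts))
    (h2 : values (symBlock m k Ω.parts) = values (symBlock m k Ω'.parts)) : Ω = Ω' := by
  ext1
  exact ext_blocks
    (eq_of_antitone_of_values_eq Ω.strictAnti.antitone Ω'.strictAnti.antitone h1)
    (eq_of_antitone_of_values_eq Ω.antitone Ω'.antitone h2)

theorem exists_parts_eq_bar {γ : Fin (m + k) → ℕ}
    (h : Function.Injective (antiBlock m k γ)) :
    ∃ Ω : Superpartition m k, Ω.parts = bar m k γ := by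
  refine ⟨⟨bar m k γ, ?_, ?_⟩, rfl⟩
  · have : Antitone (antiBlock m k (bar m k γ)) := by
      rw [antiBlock_bar]; exact sortDesc_antitone _
    refine this.strictAnti_of_injective ?_
    rw [antiBlock_bar]
    exact h.comp (Equiv.injective _)
  · have : Antitone (symBlock m k (bar m k γ)) := by
      rw [symBlock_bar]; exact sortDesc_antitone _
    exact this

theorem injective_of_parts_eq_bar {Ω : Superpartition m k} {γ : Fin (m + k) → ℕ}
    (h : Ω.parts = bar m k γ) : Function.Injective (antiBlock m k γ) := by
  have h1 : antiBlock m k Ω.parts = antiBlock m k γ ∘ sortPerm (antiBlock m k γ) := by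
    rw [h, antiBlock_bar]; rfl
  have h2 : Function.Injective (antiBlock m k γ ∘ sortPerm (antiBlock m k γ)) := by
    rw [← h1]; exact Ω.strictAnti.injective
  exact (Equiv.injective_comp _ _).1 h2

theorem symCount_eq_count (Λ : Superpartition m k) (a : ℕ) :
    symCount Λ a = (values (symBlock m k Λ.parts)).count a := by
  rw [count_values]; rfl

/-- The product of the factorials of the multiplicities of a multiset. -/
def multFactorial (s : Multiset ℕ) : ℕ := ∏ a ∈ s.toFinset, (s.count a).factorial

theorem multFactorial_eq_of_subset {s : Multiset ℕ} {t : Finset ℕ} (h : s.toFinset ⊆ t) :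
    multFactorial s = ∏ a ∈ t, (s.count a).factorial :=
  Finset.prod_subset h fun a _ ha => by
    rw [Multiset.mem_toFinset] at ha
    rw [Multiset.count_eq_zero_of_notMem ha, Nat.factorial_zero]

theorem multFactorial_cons (a : ℕ) (s : Multiset ℕ) :
    multFactorial (a ::ₘ s) = (a ::ₘ s).count a * multFactorial s := by
  have hs : s.toFinset ⊆ (a ::ₘ s).toFinset := by
    rw [Multiset.toFinset_cons]; exact Finset.subset_insert _ _
  have ha : a ∈ (a ::ₘ s).toFinset := by simp
  rw [multFactorial_eq_of_subset hs, multFactorial, ← Finset.mul_prod_erase _ _ ha,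
    ← Finset.mul_prod_erase _ _ ha, Multiset.count_cons_self, Nat.factorial_succ, mul_assoc]
  congr 2
  refine Finset.prod_congr rfl fun b hb => ?_
  rw [Multiset.count_cons_of_ne (Finset.ne_of_mem_erase hb)]

theorem fNorm_eq (Λ : Superpartition m k) :
    fNorm Λ = multFactorial (values (symBlock m k Λ.parts)) := by
  rw [multFactorial_eq_of_subset (t := Finset.univ.image Λ.parts)]
  · exact Finset.prod_congr rfl fun a _ => by rw [symCount_eq_count]
  · intro a ha
    simp only [Multiset.mem_toFinset, values, symBlock, Multiset.mem_map] at ha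
    obtain ⟨i, -, rfl⟩ := ha
    exact Finset.mem_image_of_mem _ (Finset.mem_univ _)

theorem fNorm_ne_zero (K : Type*) [Field K] [CharZero K] (Λ : Superpartition m k) :
    (fNorm Λ : K) ≠ 0 :=
  Nat.cast_ne_zero.2 (Finset.prod_ne_zero_iff.2 fun _ _ => Nat.factorial_ne_zero _)

end Blocks

/-! ## Symmetry of the symmetrised monomials -/

section Symmetry

variable {K : Type*} [Field K] {m k : ℕ}

/-- The word `θ₁ ⋯ θ_m`. -/
def thetaWord (K : Type*) [Field K] (m k : ℕ) : Grassmann K (m + k) :=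
  (List.ofFn fun i : Fin m => (theta (Fin.castAdd k i) : Grassmann K (m + k))).prod

theorem thetaWord_eq : thetaWord K m k =
    ExteriorAlgebra.ιMulti K m fun i : Fin m => Pi.single (Fin.castAdd k i) (1 : K) := by
  rw [ExteriorAlgebra.ιMulti_apply]; rfl

theorem mono_eq (Λ : Superpartition m k) :
    mono K Λ = ((fNorm Λ : K)⁻¹) • symSum (thetaWord K m k) Λ.parts := rfl

theorem symSum_eq_smul_mono [CharZero K] (Λ : Superpartition m k) :
    symSum (thetaWord K m k) Λ.parts = (fNorm Λ : K) • mono K Λ := by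
  rw [mono_eq, smul_smul, mul_inv_cancel₀ (fNorm_ne_zero K Λ), one_smul]

theorem map_thetaWord (σ : Equiv.Perm (Fin (m + k))) :
    ExteriorAlgebra.map (LinearMap.funLeft K K σ.symm) (thetaWord K m k)
      = ExteriorAlgebra.ιMulti K m fun i : Fin m =>
        Pi.single (σ (Fin.castAdd k i)) (1 : K) := by
  rw [thetaWord_eq, ExteriorAlgebra.map_apply_ιMulti]
  congr 1
  ext i a
  simp [LinearMap.funLeft_apply, Pi.single_apply, Equiv.symm_apply_eq]

/-- The permutation acting on the two blocks separately. -/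
def blockPerm (τ₁ : Equiv.Perm (Fin m)) (τ₂ : Equiv.Perm (Fin k)) : Equiv.Perm (Fin (m + k)) :=
  finSumFinEquiv.permCongr (Equiv.Perm.sumCongr τ₁ τ₂)

@[simp] theorem blockPerm_castAdd (τ₁ : Equiv.Perm (Fin m)) (τ₂ : Equiv.Perm (Fin k))
    (i : Fin m) : blockPerm τ₁ τ₂ (Fin.castAdd k i) = Fin.castAdd k (τ₁ i) := by
  simp [blockPerm, Equiv.permCongr_apply]

@[simp] theorem blockPerm_natAdd (τ₁ : Equiv.Perm (Fin m)) (τ₂ : Equiv.Perm (Fin k))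
    (i : Fin k) : blockPerm τ₁ τ₂ (Fin.natAdd m i) = Fin.natAdd m (τ₂ i) := by
  simp [blockPerm, Equiv.permCongr_apply]

/-- Moving the permutation onto the Grassmann factor reorders θ₁ ⋯ θ_m by τ₁, producing its sign.
The symmetric block carries no θ. -/
theorem symSum_comp_blockPerm (γ : Fin (m + k) → ℕ) (τ₁ : Equiv.Perm (Fin m))
    (τ₂ : Equiv.Perm (Fin k)) :
    symSum (thetaWord K m k) (γ ∘ blockPerm τ₁ τ₂)
      = ((Equiv.Perm.sign τ₁ : ℤ) : K) • symSum (thetaWord K m k) γ := by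
  have h1 : ExteriorAlgebra.map (LinearMap.funLeft K K (blockPerm τ₁ τ₂).symm)
      (thetaWord K m k) = ((Equiv.Perm.sign τ₁ : ℤ) : K) • thetaWord K m k := by
    rw [map_thetaWord, thetaWord_eq]
    have := AlternatingMap.map_perm (ExteriorAlgebra.ιMulti K m)
      (fun i : Fin m => (Pi.single (Fin.castAdd k i) (1 : K) : Fin (m + k) → K)) τ₁
    simp only [blockPerm_castAdd]
    rw [Int.cast_smul_eq_zsmul]
    exact this
  have h2 := symSum_perm (thetaWord K m k) (γ ∘ blockPerm τ₁ τ₂) (blockPerm τ₁ τ₂)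
  rw [h1] at h2
  have h3 : (γ ∘ blockPerm τ₁ τ₂) ∘ (blockPerm τ₁ τ₂).symm = γ := by
    ext; simp
  rw [h3] at h2
  rw [← h2]
  simp only [symSum, TensorProduct.tmul_smul, map_smul, Finset.smul_sum]

theorem bar_eq_comp_blockPerm (γ : Fin (m + k) → ℕ) : bar m k γ
    = γ ∘ blockPerm (sortPerm (antiBlock m k γ)) (sortPerm (symBlock m k γ)) := by
  refine ext_blocks ?_ ?_
  · rw [antiBlock_bar]; ext i; simp [antiBlock, sortDesc]
  · rw [symBlock_bar]; ext i; simp [symBlock, sortDesc]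

theorem symSum_bar (γ : Fin (m + k) → ℕ) :
    symSum (thetaWord K m k) γ
      = (antiSign m k γ : K) • symSum (thetaWord K m k) (bar m k γ) := by
  rw [bar_eq_comp_blockPerm, symSum_comp_blockPerm, smul_smul]
  have : (antiSign m k γ : K) * ((Equiv.Perm.sign (sortPerm (antiBlock m k γ)) : ℤ) : K) = 1 := by
    rw [← Int.cast_mul]
    change (((Equiv.Perm.sign (sortPerm (antiBlock m k γ)) : ℤ)
      * (Equiv.Perm.sign (sortPerm (antiBlock m k γ)) : ℤ) : ℤ) : K) = 1
    rw [← Units.val_mul, Int.units_mul_self]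
    simp
  rw [this, one_smul]

theorem symSum_comp_swap_anti (γ : Fin (m + k) → ℕ) {p q : Fin m} (h : p ≠ q) :
    symSum (thetaWord K m k) (γ ∘ Equiv.swap (Fin.castAdd k p) (Fin.castAdd k q))
      = - symSum (thetaWord K m k) γ := by
  have e : γ ∘ Equiv.swap (Fin.castAdd k p) (Fin.castAdd k q)
      = γ ∘ blockPerm (Equiv.swap p q) 1 := by
    refine ext_blocks ?_ ?_
    · ext i; simp only [antiBlock, Function.comp_apply, blockPerm_castAdd, Equiv.swap_apply_def]
      split_ifs <;> simp_all
    · ext i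
      simp only [symBlock, Function.comp_apply, blockPerm_natAdd]
      rw [Equiv.swap_apply_of_ne_of_ne] <;> simp [Fin.ext_iff] <;> omega
  rw [e, symSum_comp_blockPerm, Equiv.Perm.sign_swap h]
  simp only [Units.val_neg, Units.val_one, Int.cast_neg, Int.cast_one]
  exact neg_one_smul K (symSum (thetaWord K m k) γ)

theorem symSum_comp_swap_sym (γ : Fin (m + k) → ℕ) (p q : Fin k) :
    symSum (thetaWord K m k) (γ ∘ Equiv.swap (Fin.natAdd m p) (Fin.natAdd m q))
      = symSum (thetaWord K m k) γ := by
  have e : γ ∘ Equiv.swap (Fin.natAdd m p) (Fin.natAdd m q)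
      = γ ∘ blockPerm 1 (Equiv.swap p q) := by
    refine ext_blocks ?_ ?_
    · ext i
      simp only [antiBlock, Function.comp_apply, blockPerm_castAdd]
      rw [Equiv.swap_apply_of_ne_of_ne] <;> simp [Fin.ext_iff] <;> omega
    · ext i; simp only [symBlock, Function.comp_apply, blockPerm_natAdd, Equiv.swap_apply_def]
      split_ifs <;> simp_all
  rw [e, symSum_comp_blockPerm]
  simp

/-- Exchanging two equal antisymmetric entries fixes γ but changes the sign, so the sum is its own
negative. -/
theorem symSum_eq_zero [CharZero K] {γ : Fin (m + k) → ℕ}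
    (h : ¬ Function.Injective (antiBlock m k γ)) : symSum (thetaWord K m k) γ = 0 := by
  simp only [Function.Injective, not_forall] at h
  obtain ⟨p, q, he, hne⟩ := h
  have h1 := symSum_comp_swap_anti (K := K) γ hne
  have h2 : γ ∘ Equiv.swap (Fin.castAdd k p) (Fin.castAdd k q) = γ := by
    ext a
    simp only [Function.comp_apply, Equiv.swap_apply_def]
    have : γ (Fin.castAdd k p) = γ (Fin.castAdd k q) := he
    split_ifs <;> simp_all
  rw [h2] at h1
  have h3 : (2 : K) • symSum (thetaWord K m k) γ = 0 := by
    rw [two_smul]; nth_rewrite 1 [h1]; exact neg_add_cancel _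
  exact (smul_eq_zero.1 h3).resolve_left two_ne_zero

end Symmetry

/-! ## Linear independence of the monomial symmetric superpolynomials -/

section Independence

variable {K : Type*} [Field K] {m k : ℕ}

/-- The linear functional on the Grassmann algebra that extracts the coefficient of
`θ₁ ⋯ θ_m`. -/
def wordCoeff (K : Type*) [Field K] (m k : ℕ) : Grassmann K (m + k) →ₗ[K] K :=
  ExteriorAlgebra.liftAlternating fun i =>
    if h : i = m then
      (Matrix.detRowAlternating.compLinearMap (LinearMap.funLeft K K (Fin.castAdd k))).domDomCongr
        (finCongr h.symm)
    else 0

theorem wordCoeff_ιMulti (v : Fin m → Fin (m + k) → K) :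
    wordCoeff K m k (ExteriorAlgebra.ιMulti K m v)
      = Matrix.det (Matrix.of fun i j => v i (Fin.castAdd k j)) := by
  rw [wordCoeff, ExteriorAlgebra.liftAlternating_apply_ιMulti, dif_pos rfl]
  rfl

/-- The linear functional that extracts the coefficient of `z^γ θ₁ ⋯ θ_m`. -/
def termCoeff (K : Type*) [Field K] (m k : ℕ) (γ : Fin (m + k) → ℕ) :
    SuperPoly K (m + k) →ₗ[K] K :=
  LinearMap.mul' K K ∘ₗ TensorProduct.map
    (MvPolynomial.lcoeff K (Finsupp.equivFunOnFinite.symm γ)) (wordCoeff K m k)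

theorem termCoeff_tmul (γ : Fin (m + k) → ℕ) (p : MvPolynomial (Fin (m + k)) K)
    (w : Grassmann K (m + k)) : termCoeff K m k γ (p ⊗ₜ[K] w)
      = p.coeff (Finsupp.equivFunOnFinite.symm γ) * wordCoeff K m k w := rfl

theorem coeff_zmon (γ δ : Fin (m + k) → ℕ) :
    (zmon K δ).coeff (Finsupp.equivFunOnFinite.symm γ) = if δ = γ then 1 else 0 := by
  classical
  rw [zmon_eq_monomial, MvPolynomial.coeff_monomial]
  simp

/-- A nonzero coefficient would force σ to preserve the first m positions, since otherwise the
determinant has a zero row, and to carry Λ to Ω. The two blocks would then have equal multisets. -/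
theorem termCoeff_permAct_of_ne {Λ Ω : Superpartition m k} (h : Λ ≠ Ω)
    (σ : Equiv.Perm (Fin (m + k))) :
    termCoeff K m k Ω.parts (permAct (K := K) σ (zmon K Λ.parts ⊗ₜ[K] thetaWord K m k)) = 0 := by
  rw [permAct_tmul, rename_zmon, map_thetaWord, termCoeff_tmul, coeff_zmon, wordCoeff_ιMulti]
  by_contra hne
  rw [mul_eq_zero, not_or] at hne
  have h1 : Λ.parts ∘ σ.symm = Ω.parts := by
    by_contra hc; exact hne.1 (if_neg hc)
  have h2 : ∀ i : Fin m, ∃ j : Fin m, σ (Fin.castAdd k i) = Fin.castAdd k j := by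
    intro i
    by_contra hc
    push Not at hc
    refine hne.2 (Matrix.det_eq_zero_of_row_eq_zero i fun j => ?_)
    simp [(hc j).symm]
  choose f hf using h2
  have hfi : Function.Injective f := by
    intro a b hab
    have : σ (Fin.castAdd k a) = σ (Fin.castAdd k b) := by rw [hf, hf, hab]
    exact Fin.castAdd_injective m k (σ.injective this)
  let e : Equiv.Perm (Fin m) := Equiv.ofBijective f (Finite.injective_iff_bijective.1 hfi)
  have h3 : antiBlock m k Λ.parts = antiBlock m k Ω.parts ∘ e := by
    ext i
    rw [← h1]
    simp only [antiBlock, Function.comp_apply, e, Equiv.ofBijective_apply, ← hf,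
      Equiv.symm_apply_apply]
  have ha : values (antiBlock m k Λ.parts) = values (antiBlock m k Ω.parts) := by
    rw [h3, values_comp_perm]
  have hall : values Λ.parts = values Ω.parts := by
    rw [← h1, values_comp_perm]
  have hsplit : ∀ γ : Fin (m + k) → ℕ,
      values γ = values (antiBlock m k γ) + values (symBlock m k γ) := by
    intro γ
    have : (Finset.univ : Finset (Fin (m + k))).val
        = (Finset.univ.val.map (Fin.castAdd k) + Finset.univ.val.map (Fin.natAdd m)) := by
      have h := Multiset.map_univ_val_equiv (finSumFinEquiv (m := m) (n := k))
      rw [← h]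
      change Multiset.map _ (Multiset.disjSum _ _) = _
      simp [Multiset.disjSum, Function.comp_def]
    rw [values, this, Multiset.map_add, Multiset.map_map, Multiset.map_map]
    rfl
  rw [hsplit, hsplit Ω.parts, ha] at hall
  exact h (superpartition_eq_of_values ha (add_left_cancel hall))

/-- Contributions are 0 or 1, never -1: a σ that contributes preserves the antisymmetric positions
and the parts, and distinctness of these parts makes it fix each such position. Hence summing over σ
cannot cancel. -/
theorem termCoeff_permAct_self (Λ : Superpartition m k) (σ : Equiv.Perm (Fin (m + k))) :
    ∃ c : ℕ, termCoeff K m k Λ.parts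
      (permAct (K := K) σ (zmon K Λ.parts ⊗ₜ[K] thetaWord K m k)) = c := by
  rw [permAct_tmul, rename_zmon, map_thetaWord, termCoeff_tmul, coeff_zmon, wordCoeff_ιMulti]
  by_cases h1 : Λ.parts ∘ σ.symm = Λ.parts
  swap
  · exact ⟨0, by rw [if_neg h1]; simp⟩
  by_cases h2 : ∀ i : Fin m, ∃ j : Fin m, σ (Fin.castAdd k i) = Fin.castAdd k j
  swap
  · push Not at h2
    obtain ⟨i, hi⟩ := h2
    refine ⟨0, ?_⟩
    rw [Matrix.det_eq_zero_of_row_eq_zero i fun j => by simp [(hi j).symm]]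
    simp
  refine ⟨1, ?_⟩
  have h3 : ∀ i : Fin m, σ (Fin.castAdd k i) = Fin.castAdd k i := by
    intro i
    obtain ⟨j, hj⟩ := h2 i
    have := congrFun h1 (σ (Fin.castAdd k i))
    simp only [Function.comp_apply, Equiv.symm_apply_apply] at this
    rw [hj] at this
    rw [hj, Λ.strictAnti.injective this]
  have h4 : (Matrix.of fun i j : Fin m =>
      (Pi.single (σ (Fin.castAdd k i)) (1 : K) : Fin (m + k) → K) (Fin.castAdd k j)) = 1 := by
    ext i j
    simp [h3, Pi.single_apply, Matrix.one_apply, eq_comm]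
  rw [h4, Matrix.det_one, if_pos h1]
  simp

theorem termCoeff_mono_of_ne {Λ Ω : Superpartition m k} (h : Λ ≠ Ω) :
    termCoeff K m k Ω.parts (mono K Λ) = 0 := by
  rw [mono_eq, map_smul, symSum, map_sum,
    Finset.sum_eq_zero fun σ _ => termCoeff_permAct_of_ne h σ, smul_zero]

/-- The coefficient is a nonzero multiple of a sum of natural numbers in which the identity
contributes a positive term; characteristic 0 keeps it nonzero. -/
theorem termCoeff_mono_self [CharZero K] (Λ : Superpartition m k) :
    termCoeff K m k Λ.parts (mono K Λ) ≠ 0 := by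
  rw [mono_eq, map_smul, symSum, map_sum]
  refine smul_ne_zero (inv_ne_zero (fNorm_ne_zero K Λ)) ?_
  choose c hc using termCoeff_permAct_self (K := K) Λ
  rw [Finset.sum_congr rfl fun σ _ => hc σ, ← Nat.cast_sum, Nat.cast_ne_zero]
  have h1 : c 1 ≠ 0 := by
    have := hc 1
    rw [permAct_tmul, rename_zmon, map_thetaWord, termCoeff_tmul, coeff_zmon,
      wordCoeff_ιMulti,
      if_pos (show Λ.parts ∘ (1 : Equiv.Perm (Fin (m + k))).symm = Λ.parts from rfl)] at this
    have h4 : (Matrix.of fun i j : Fin m =>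
        (Pi.single ((1 : Equiv.Perm (Fin (m + k))) (Fin.castAdd k i)) (1 : K) :
          Fin (m + k) → K) (Fin.castAdd k j)) = 1 := by
      ext i j
      simp [Pi.single_apply, Matrix.one_apply, eq_comm]
    rw [h4, Matrix.det_one] at this
    intro h0
    rw [h0] at this
    simp at this
  intro h0
  exact h1 (Finset.sum_eq_zero_iff.1 h0 1 (Finset.mem_univ _))

end Independence

/-! ## Dominance and eigenvalues -/

section Dominance

variable {n : ℕ}

/-- Take the threshold t = μ_i: for μ only the first i entries exceed it, while for ω every partial
sum is bounded by the excesses. Excess sums ignore the order of the entries, so they can be followed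
through lowerings without sorting. -/
theorem domLE_of_excess_le {ω μ : Fin n → ℕ} (hμ : Antitone μ) (hs : ∑ j, ω j = ∑ j, μ j)
    (h : ∀ t, ∑ j, (ω j - t) ≤ ∑ j, (μ j - t)) : DomLE ω μ := by
  refine ⟨hs, fun i => ?_⟩
  have h1 : ∑ j ∈ Finset.Iic i, ω j ≤ ∑ j ∈ Finset.Iic i, (μ i + (ω j - μ i)) :=
    Finset.sum_le_sum fun j _ => by omega
  have h2 : ∑ j ∈ Finset.Iic i, (ω j - μ i) ≤ ∑ j, (ω j - μ i) :=
    Finset.sum_le_sum_of_subset (Finset.subset_univ _)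
  have h3 : ∑ j, (μ j - μ i) = ∑ j ∈ Finset.Iic i, (μ j - μ i) := by
    refine (Finset.sum_subset (Finset.subset_univ _) fun j _ hj => ?_).symm
    rw [Finset.mem_Iic, not_le] at hj
    exact Nat.sub_eq_zero_of_le (hμ hj.le)
  have h4 : ∑ j ∈ Finset.Iic i, (μ i + (μ j - μ i)) = ∑ j ∈ Finset.Iic i, μ j :=
    Finset.sum_congr rfl fun j hj => Nat.add_sub_cancel' (hμ (Finset.mem_Iic.1 hj))
  rw [Finset.sum_add_distrib] at h1 h4
  have := h (μ i)
  omega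

theorem sum_update_update {A : Type*} [AddCommMonoid A] (γ : Fin n → ℕ) {i j : Fin n}
    (h : i ≠ j) (a b : ℕ) (g : ℕ → A) :
    g (γ i) + (g (γ j) + ∑ l, g (Function.update (Function.update γ i a) j b l))
      = g a + (g b + ∑ l, g (γ l)) := by
  have h1 := cons_values_update γ i a
  have h2 := cons_values_update (Function.update γ i a) j b
  rw [Function.update_of_ne h.symm] at h2
  have h3 := congrArg (fun s => (Multiset.map g s).sum) h1
  have h4 := congrArg (fun s => (Multiset.map g s).sum) h2
  simp only [Multiset.map_cons, Multiset.sum_cons, sum_values] at h3 h4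
  rw [h4, add_left_comm, h3, add_left_comm]

/-- The entry `i` of `R_{ij}^{(ℓ)} γ`. -/
def lowFst (γ : Fin n → ℕ) (i j : Fin n) (ℓ : ℕ) : ℕ :=
  if γ j < γ i then γ i - ℓ else γ i + ℓ

/-- The entry `j` of `R_{ij}^{(ℓ)} γ`. -/
def lowSnd (γ : Fin n → ℕ) (i j : Fin n) (ℓ : ℕ) : ℕ :=
  if γ j < γ i then γ j + ℓ else γ j - ℓ

theorem lower_eq (γ : Fin n → ℕ) (i j : Fin n) (ℓ : ℕ) : lower γ i j ℓ
    = Function.update (Function.update γ i (lowFst γ i j ℓ)) j (lowSnd γ i j ℓ) := by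
  unfold lower lowFst lowSnd
  split_ifs <;> rfl

theorem lower_zero (γ : Fin n → ℕ) (i j : Fin n) : lower γ i j 0 = γ := by
  unfold lower
  split_ifs <;> simp

theorem Admissible.lt_gap {m : ℕ} {γ : Fin n → ℕ} {i j : Fin n} {ℓ : ℕ}
    (h : Admissible m γ i j ℓ) (hℓ : 0 < ℓ) : ℓ < gap γ i j := by
  unfold gap
  obtain ⟨-, ⟨-, h⟩ | ⟨-, h⟩ | ⟨-, h⟩⟩ := h
  · omega
  · rw [Int.abs_eq_natAbs] at h; omega
  · omega

/-- Convexity of a ↦ max(a - t, 0): lowering brings two entries together while keeping their sum. -/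
theorem excess_lower_le (γ : Fin n → ℕ) {i j : Fin n} (hij : i ≠ j) {ℓ : ℕ}
    (h : ℓ < gap γ i j) (t : ℕ) : ∑ l, (lower γ i j ℓ l - t) ≤ ∑ l, (γ l - t) := by
  have := sum_update_update γ hij (lowFst γ i j ℓ) (lowSnd γ i j ℓ) fun a => a - t
  rw [← lower_eq] at this
  have h2 : lowFst γ i j ℓ - t + (lowSnd γ i j ℓ - t) ≤ γ i - t + (γ j - t) := by
    unfold gap at h
    unfold lowFst lowSnd
    split_ifs <;> omega
  omega

theorem sum_lower (γ : Fin n → ℕ) {i j : Fin n} (hij : i ≠ j) {ℓ : ℕ}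
    (h : ℓ < gap γ i j) : ∑ l, lower γ i j ℓ l = ∑ l, γ l := by
  have := sum_update_update γ hij (lowFst γ i j ℓ) (lowSnd γ i j ℓ) id
  rw [← lower_eq] at this
  simp only [id] at this
  have h2 : lowFst γ i j ℓ + lowSnd γ i j ℓ = γ i + γ j := by
    unfold gap at h
    unfold lowFst lowSnd
    split_ifs <;> omega
  omega

theorem sum_sq_lower_lt (γ : Fin n → ℕ) {i j : Fin n} (hij : i ≠ j) {ℓ : ℕ} (h0 : 0 < ℓ)
    (h : ℓ < gap γ i j) : ∑ l, lower γ i j ℓ l ^ 2 < ∑ l, γ l ^ 2 := by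
  have := sum_update_update γ hij (lowFst γ i j ℓ) (lowSnd γ i j ℓ) fun a => a ^ 2
  rw [← lower_eq] at this
  -- The two sides differ by 2eℓ.
  have key : ∀ y e : ℕ, 0 < e → (y + e) ^ 2 + (y + ℓ) ^ 2 < (y + e + ℓ) ^ 2 + y ^ 2 := by
    intro y e he
    nlinarith [Nat.mul_pos he h0]
  have h2 : lowFst γ i j ℓ ^ 2 + lowSnd γ i j ℓ ^ 2 < γ i ^ 2 + γ j ^ 2 := by
    unfold gap at h
    unfold lowFst lowSnd
    split_ifs with hc
    · obtain ⟨e, he⟩ : ∃ e, γ i = γ j + e + ℓ := ⟨γ i - γ j - ℓ, by omega⟩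
      have := key (γ j) e (by omega)
      rw [he, Nat.add_sub_cancel]
      exact this
    · obtain ⟨e, he⟩ : ∃ e, γ j = γ i + e + ℓ := ⟨γ j - γ i - ℓ, by omega⟩
      have := key (γ i) e (by omega)
      rw [he, Nat.add_sub_cancel]
      omega
  omega

/-- Abel summation as an induction: the smaller bound `c` on the weights is first replaced by the
last weight, which is legitimate because the total is nonnegative. -/
theorem mul_sum_le_sum_mul {n : ℕ} (w x : Fin n → ℤ) (hw : Antitone w)
    (hx : ∀ i, 0 ≤ ∑ j, if j ≤ i then x j else 0) (c : ℤ) (hc : ∀ i, c ≤ w i) :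
    c * ∑ i, x i ≤ ∑ i, w i * x i := by
  induction n generalizing c with
  | zero => simp
  | succ n ih =>
    rw [Fin.sum_univ_castSucc, Fin.sum_univ_castSucc]
    have h1 := ih (fun i => w i.castSucc) (fun i => x i.castSucc)
      (fun i j hij => hw (Fin.castSucc_le_castSucc_iff.2 hij))
      (fun i => by
        have := hx i.castSucc
        rw [Fin.sum_univ_castSucc] at this
        simpa [Fin.castSucc_le_castSucc_iff, (Fin.castSucc_lt_last i).not_ge] using this)
      (w (Fin.last n)) (fun i => hw (Fin.le_last _))
    have h2 := hx (Fin.last n)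
    rw [Fin.sum_univ_castSucc] at h2
    simp only [Fin.le_last, if_true] at h2
    have h3 := mul_le_mul_of_nonneg_right (hc (Fin.last n)) h2
    nlinarith

theorem sum_mul_nonneg_of_domLE {ω μ : Fin n → ℕ} (h : DomLE ω μ) (w : Fin n → ℤ)
    (hw : Antitone w) : 0 ≤ ∑ i, w i * ((μ i : ℤ) - ω i) := by
  rcases n with _ | n
  · simp
  have h1 := mul_sum_le_sum_mul w (fun i => (μ i : ℤ) - ω i) hw
    (fun i => by
      rw [← Finset.sum_filter, Finset.sum_sub_distrib, sub_nonneg]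
      have := h.2 i
      have e : (Finset.univ.filter fun j => j ≤ i) = Finset.Iic i := by ext; simp
      rw [e]
      exact_mod_cast this)
    (w (Fin.last n)) (fun i => hw (Fin.le_last _))
  have h2 : ∑ i, ((μ i : ℤ) - ω i) = 0 := by
    rw [Finset.sum_sub_distrib, sub_eq_zero]
    exact_mod_cast h.1.symm
  rwa [h2, mul_zero] at h1

/-- Write μ² - ω² = (μ - ω)² + 2ω(μ - ω). The first sum is positive since ω ≠ μ; the second is
nonnegative by dominance with the decreasing weights 2ω. -/
theorem sum_sq_pos_of_domLT {ω μ : Fin n → ℕ} (hω : Antitone ω) (h : DomLT ω μ) :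
    0 < ∑ i, ((μ i : ℤ) ^ 2 - (ω i : ℤ) ^ 2) := by
  have h1 := sum_mul_nonneg_of_domLE h.1 (fun i => 2 * (ω i : ℤ)) fun i j hij => by
    have := hω hij
    dsimp only; omega
  have h2 : 0 < ∑ i, ((μ i : ℤ) - ω i) ^ 2 := by
    obtain ⟨i, hi⟩ := Function.ne_iff.1 h.2
    refine Finset.sum_pos' (fun i _ => sq_nonneg _) ⟨i, Finset.mem_univ _, ?_⟩
    have : (μ i : ℤ) - ω i ≠ 0 := by omega
    positivity
  have h3 : ∑ i, ((μ i : ℤ) ^ 2 - (ω i : ℤ) ^ 2)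
      = ∑ i, ((μ i : ℤ) - ω i) ^ 2 + ∑ i, 2 * (ω i : ℤ) * ((μ i : ℤ) - ω i) := by
    rw [← Finset.sum_add_distrib]
    exact Finset.sum_congr rfl fun i _ => by ring
  omega

end Dominance

/-! ### From lowering operators to dominance -/

section Order

variable {m k : ℕ}

theorem star_antitone (Λ : Superpartition m k) : Antitone (star Λ) := sortDesc_antitone _

theorem sum_star {A : Type*} [AddCommMonoid A] (Λ : Superpartition m k) (g : ℕ → A) :
    ∑ i, g (star Λ i) = ∑ i, g (Λ.parts i) :=
  Equiv.sum_comp (sortPerm Λ.parts) fun i => g (Λ.parts i)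

theorem sum_eq_of_parts_eq_bar {A : Type*} [AddCommMonoid A] {Ω : Superpartition m k}
    {γ : Fin (m + k) → ℕ} (h : Ω.parts = bar m k γ) (g : ℕ → A) :
    ∑ i, g (Ω.parts i) = ∑ i, g (γ i) := by
  rw [h, bar_eq_comp_blockPerm]
  exact Equiv.sum_comp (blockPerm _ _) fun i => g (γ i)

theorem Lowers.eq_of_zero {Λ Ω : Superpartition m k} {i j : Fin (m + k)}
    (h : Lowers Λ Ω i j 0) : Ω = Λ := by
  have := h.2
  rw [lower_zero, parts_eq_bar_iff] at this
  exact superpartition_eq_of_values this.1 this.2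

/-- The sum of the squares of the parts. -/
def sumSq (Λ : Superpartition m k) : ℕ := ∑ i, Λ.parts i ^ 2

theorem Lowers.sumSq_lt {Λ Ω : Superpartition m k} {i j : Fin (m + k)} {ℓ : ℕ}
    (h : Lowers Λ Ω i j ℓ) (hℓ : 0 < ℓ) : sumSq Ω < sumSq Λ := by
  unfold sumSq
  rw [sum_eq_of_parts_eq_bar h.2 fun a => a ^ 2]
  exact sum_sq_lower_lt _ h.1.1.ne hℓ (h.1.lt_gap hℓ)

theorem SLE.sum_eq_and_excess_le {Λ Ω : Superpartition m k} (h : SLE Ω Λ) :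
    ∑ i, Ω.parts i = ∑ i, Λ.parts i ∧
      ∀ t, ∑ i, (Ω.parts i - t) ≤ ∑ i, (Λ.parts i - t) := by
  induction h with
  | refl => exact ⟨rfl, fun _ => le_rfl⟩
  | tail _ hs ih =>
    obtain ⟨i, j, ℓ, hs⟩ := hs
    rcases Nat.eq_zero_or_pos ℓ with rfl | hℓ
    · rw [hs.eq_of_zero]; exact ih
    · have hg := hs.1.lt_gap hℓ
      refine ⟨?_, fun t => ?_⟩
      · exact (sum_eq_of_parts_eq_bar hs.2 id).trans
          ((sum_lower _ hs.1.1.ne hg).trans ih.1)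
      · rw [sum_eq_of_parts_eq_bar hs.2 fun a => a - t]
        exact (excess_lower_le _ hs.1.1.ne hg t).trans (ih.2 t)

/-- Steps with ℓ = 0 are allowed but do nothing; every other step strictly decreases the sum of
squares. -/
theorem SLE.eq_or_sumSq_lt {Λ Ω : Superpartition m k} (h : SLE Ω Λ) :
    Ω = Λ ∨ sumSq Ω < sumSq Λ := by
  induction h with
  | refl => exact Or.inl rfl
  | tail _ hs ih =>
    obtain ⟨i, j, ℓ, hs⟩ := hs
    rcases Nat.eq_zero_or_pos ℓ with rfl | hℓ
    · rw [hs.eq_of_zero]; exact ih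
    · have := hs.sumSq_lt hℓ
      rcases ih with rfl | ih
      · exact Or.inr this
      · exact Or.inr (this.trans ih)

theorem SLT.domLT {Λ Ω : Superpartition m k} (h : SLT Ω Λ) : DomLT (star Ω) (star Λ) := by
  obtain ⟨h1, h2⟩ := h.1.sum_eq_and_excess_le
  refine ⟨domLE_of_excess_le (star_antitone Λ) ?_ fun t => ?_, fun e => ?_⟩
  · exact (sum_star Ω id).trans (h1.trans (sum_star Λ id).symm)
  · rw [sum_star Ω fun a => a - t, sum_star Λ fun a => a - t]
    exact h2 t
  · have h3 := h.1.eq_or_sumSq_lt.resolve_left h.2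
    unfold sumSq at h3
    rw [← sum_star Ω fun a => a ^ 2, ← sum_star Λ fun a => a ^ 2, e] at h3
    exact lt_irrefl _ h3

end Order

/-! ### Formula for the eigenvalues and their separation -/

section Eigenvalues

variable {K : Type*} [Field K] {m k : ℕ}

/-- With positions counted from 0, entry j occurs positively in n - 1 - j pairs and negatively in j
of them. -/
theorem sum_Ioi_sub {n : ℕ} (g : Fin n → K) :
    ∑ i : Fin n, ∑ j ∈ Finset.Ioi i, (g i - g j)
      = ∑ j : Fin n, ((n : K) + 1 - 2 * (((j : ℕ) : K) + 1)) * g j := by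
  have h : ∑ i : Fin n, ∑ j ∈ Finset.Ioi i, g j = ∑ j : Fin n, ∑ i ∈ Finset.Iio j, g j :=
    Finset.sum_comm' (by simp)
  simp only [Finset.sum_sub_distrib, h]
  rw [← Finset.sum_sub_distrib]
  refine Finset.sum_congr rfl fun j _ => ?_
  rw [Finset.sum_const, Finset.sum_const, Fin.card_Ioi, Fin.card_Iio, nsmul_eq_mul, nsmul_eq_mul]
  have : n - 1 - (j : ℕ) + (j + 1) = n := by have := j.isLt; omega
  have h2 := congrArg (Nat.cast : ℕ → K) this
  rw [Nat.cast_add, Nat.cast_add, Nat.cast_one] at h2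
  linear_combination g j * h2

theorem eigenvalue_eq_diagCoeff [CharZero K] (β : K) (Λ : Superpartition m k) :
    eigenvalue β Λ = diagCoeff β Λ.parts := by
  have h1 : ∑ i : Fin (m + k), ∑ j ∈ Finset.Ioi i, (gap Λ.parts i j : K)
      = ∑ i : Fin (m + k), ∑ j ∈ Finset.Ioi i, ((star Λ i : K) - star Λ j) := by
    rw [← sum_Ioi_comp_perm K (fun i j => (gap Λ.parts i j : K))
      (fun i j => by rw [gap_comm]) (sortPerm Λ.parts)]
    refine Finset.sum_congr rfl fun i _ => Finset.sum_congr rfl fun j hj => ?_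
    have h : star Λ j ≤ star Λ i := star_antitone Λ (Finset.mem_Ioi.1 hj).le
    rw [← Nat.cast_sub h]
    congr 1
    change _ = Λ.parts (sortPerm Λ.parts i) - Λ.parts (sortPerm Λ.parts j)
    change Λ.parts (sortPerm Λ.parts j) ≤ Λ.parts (sortPerm Λ.parts i) at h
    unfold gap
    omega
  rw [diagCoeff, h1, sum_Ioi_sub (fun i => (star Λ i : K)),
    ← sum_star Λ fun a => (a : K) ^ 2, Finset.mul_sum, ← Finset.sum_add_distrib]
  exact Finset.sum_congr rfl fun j _ => by ring

/-- The difference is P + βQ, with P > 0 from the squares and Q ≥ 0 from the decreasing weights N +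
1 - 2j. If Q = 0 it is nonzero; otherwise its vanishing means β = -P/Q. -/
theorem eigenvalue_ne_of_domLT [CharZero K] {β : K} (hβ : ∀ q : ℚ, q < 0 → β ≠ (q : K))
    {Ω Λ : Superpartition m k} (h : DomLT (star Ω) (star Λ)) :
    eigenvalue β Ω ≠ eigenvalue β Λ := by
  intro he
  have hP := sum_sq_pos_of_domLT (star_antitone Ω) h
  have hQ := sum_mul_nonneg_of_domLE h.1
    (fun j : Fin (m + k) => ((m + k : ℕ) : ℤ) + 1 - 2 * (((j : ℕ) : ℤ) + 1)) fun i j hij => by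
      have : (i : ℕ) ≤ j := hij
      dsimp only; omega
  set P : ℤ := ∑ i, ((star Λ i : ℤ) ^ 2 - (star Ω i : ℤ) ^ 2) with hPd
  set Q : ℤ := ∑ j : Fin (m + k), (((m + k : ℕ) : ℤ) + 1 - 2 * (((j : ℕ) : ℤ) + 1))
    * ((star Λ j : ℤ) - star Ω j) with hQd
  have key : (P : K) + β * (Q : K) = 0 := by
    rw [← sub_eq_zero.2 he.symm, hPd, hQd, eigenvalue, eigenvalue, Int.cast_sum, Int.cast_sum,
      Finset.mul_sum, ← Finset.sum_add_distrib, ← Finset.sum_sub_distrib]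
    refine Finset.sum_congr rfl fun j _ => ?_
    push_cast
    ring
  rcases hQ.eq_or_lt with h0 | h0
  · rw [← h0, Int.cast_zero, mul_zero, add_zero, Int.cast_eq_zero] at key
    omega
  · have hQK : (Q : K) ≠ 0 := Int.cast_ne_zero.2 h0.ne'
    refine hβ (-(P : ℚ) / Q) ?_ ?_
    · have h1 : (0 : ℚ) < P := by exact_mod_cast hP
      have h2 : (0 : ℚ) < Q := by exact_mod_cast h0
      rw [neg_div]
      exact neg_neg_of_pos (div_pos h1 h2)
    · push_cast
      rw [eq_div_iff hQK]
      linear_combination key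

end Eigenvalues

/-! ## Lowering operators and rearrangement classes -/

section MultisetExchange

/-- Since x ≠ a, removal and insertion do not cancel, so the two multisets determine both values. -/
theorem eq_of_cons_exchange {M M' : Multiset ℕ} {x a x' a' : ℕ} (h : x ::ₘ M' = a ::ₘ M)
    (h' : x' ::ₘ M' = a' ::ₘ M) (hne : x ≠ a) : x = x' ∧ a = a' := by
  have e : ({x, a'} : Multiset ℕ) = {x', a} := by
    refine add_right_cancel (b := M) ?_
    simp only [Multiset.insert_eq_cons, Multiset.cons_add, Multiset.singleton_add]
    rw [← h', ← h, Multiset.cons_swap]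
  have h1 : x ∈ ({x', a} : Multiset ℕ) := by rw [← e]; simp
  have h2 : a ∈ ({x, a'} : Multiset ℕ) := by rw [e]; simp
  simp only [Multiset.insert_eq_cons, Multiset.mem_cons, Multiset.mem_singleton] at h1 h2
  omega

/-- The nesting y < b ≤ a < x excludes a coincidence between a removed and an inserted value, so
nothing cancels and the exchange can be recovered. -/
theorem eq_of_cons_cons_exchange {M M' : Multiset ℕ} {x y a b x' y' a' b' : ℕ}
    (h : x ::ₘ y ::ₘ M' = a ::ₘ b ::ₘ M) (h' : x' ::ₘ y' ::ₘ M' = a' ::ₘ b' ::ₘ M)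
    (h1 : y < b) (h2 : b ≤ a) (h3 : a < x) (h1' : y' < b') (h2' : b' ≤ a') (h3' : a' < x') :
    x = x' ∧ y = y' ∧ a = a' := by
  have e : ({x, y, a', b'} : Multiset ℕ) = {x', y', a, b} := by
    refine add_right_cancel (b := M) ?_
    simp only [Multiset.insert_eq_cons, Multiset.cons_add, Multiset.singleton_add]
    rw [← h', ← h, Multiset.cons_swap y, Multiset.cons_swap x, Multiset.cons_swap y,
      Multiset.cons_swap x]
  have hx : x ∈ ({x', y', a, b} : Multiset ℕ) := by rw [← e]; simp
  have hy : y ∈ ({x', y', a, b} : Multiset ℕ) := by rw [← e]; simp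
  have ha' : a' ∈ ({x', y', a, b} : Multiset ℕ) := by rw [← e]; simp
  have hx' : x' ∈ ({x, y, a', b'} : Multiset ℕ) := by rw [e]; simp
  have hy' : y' ∈ ({x, y, a', b'} : Multiset ℕ) := by rw [e]; simp
  have ha : a ∈ ({x, y, a', b'} : Multiset ℕ) := by rw [e]; simp
  simp only [Multiset.insert_eq_cons, Multiset.mem_cons, Multiset.mem_singleton] at *
  have e1 : x = x' := by omega
  have e2 : y = y' := by omega
  omega

theorem ne_of_cons_exchange {M M' : Multiset ℕ} {x a : ℕ} (h : x ::ₘ M' = a ::ₘ M)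
    (hne : x ≠ a) : M' ≠ M := by
  rintro rfl
  exact hne ((Multiset.cons_inj_left _).1 h)

theorem ne_of_cons_cons_exchange {M M' : Multiset ℕ} {x y a b : ℕ}
    (h : x ::ₘ y ::ₘ M' = a ::ₘ b ::ₘ M) (h1 : a < x) (h2 : b < x) : M' ≠ M := by
  rintro rfl
  have := congrArg (Multiset.count x) h
  rw [Multiset.count_cons_self, Multiset.count_cons_of_ne h1.ne', Multiset.count_cons_of_ne h2.ne']
    at this
  have := Multiset.count_le_count_cons x y M'
  omega

/-- Compute the factorial product of the common enlarged multiset from both sides. This evaluates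
the ratio f_Ω/f_Λ for type II. -/
theorem multFactorial_cons_exchange {M M' : Multiset ℕ} {x a : ℕ} (h : x ::ₘ M' = a ::ₘ M)
    (hne : x ≠ a) :
    M.count x * multFactorial M' = M'.count a * multFactorial M := by
  have h1 := multFactorial_cons x M'
  rw [h, multFactorial_cons, Multiset.count_cons_of_ne hne, ← h,
    Multiset.count_cons_of_ne hne.symm] at h1
  exact h1.symm

/-- The same comparison with two elements on each side. When a = b, adding them one after the other
gives n(n - 1), the source of the special symmetry factor for equal parts. -/
theorem multFactorial_cons_cons_exchange {M M' : Multiset ℕ} {x y a b : ℕ}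
    (h : x ::ₘ y ::ₘ M' = a ::ₘ b ::ₘ M) (h1 : y < b) (h2 : b ≤ a) (h3 : a < x) :
    M.count x * M.count y * multFactorial M'
      = M'.count a * (if a = b then M'.count a - 1 else M'.count b) * multFactorial M := by
  have hx : Multiset.count x (x ::ₘ y ::ₘ M') = M.count x := by
    rw [h, Multiset.count_cons_of_ne h3.ne', Multiset.count_cons_of_ne (by omega)]
  have hy : Multiset.count y (y ::ₘ M') = M.count y := by
    rw [← Multiset.count_cons_of_ne (by omega : y ≠ x) (y ::ₘ M'), h,
      Multiset.count_cons_of_ne (by omega), Multiset.count_cons_of_ne (by omega)]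
  have ha : Multiset.count a (a ::ₘ b ::ₘ M) = M'.count a := by
    rw [← h, Multiset.count_cons_of_ne (by omega), Multiset.count_cons_of_ne (by omega)]
  have hb : Multiset.count b (b ::ₘ M) = if a = b then M'.count a - 1 else M'.count b := by
    split_ifs with hab
    · subst hab
      rw [← ha]
      simp only [Multiset.count_cons_self]
      omega
    · rw [← Multiset.count_cons_of_ne (Ne.symm hab) (b ::ₘ M), ← h,
        Multiset.count_cons_of_ne (by omega), Multiset.count_cons_of_ne (by omega)]
  have e := congrArg multFactorial h
  rw [multFactorial_cons, multFactorial_cons, multFactorial_cons, multFactorial_cons, hx, hy, ha,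
    hb] at e
  rw [mul_assoc, e, mul_assoc]

end MultisetExchange

/-! ### Lowerings of the three types as multiset exchanges -/

section Types

variable {m k : ℕ}

theorem admissible_castAdd_castAdd (γ : Fin (m + k) → ℕ) (p q : Fin m) (ℓ : ℕ) :
    Admissible m γ (Fin.castAdd k p) (Fin.castAdd k q) ℓ ↔
      p < q ∧ γ (Fin.castAdd k q) + 2 * ℓ < γ (Fin.castAdd k p) := by
  have hp := p.isLt
  have hq := q.isLt
  simp only [Admissible, TypeI, TypeII, TypeIII, Fin.val_castAdd, Fin.lt_def]
  omega

theorem admissible_castAdd_natAdd (γ : Fin (m + k) → ℕ) (p : Fin m) (q : Fin k) (ℓ : ℕ) :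
    Admissible m γ (Fin.castAdd k p) (Fin.natAdd m q) ℓ ↔
      ℓ < gap γ (Fin.castAdd k p) (Fin.natAdd m q) := by
  have hp := p.isLt
  simp only [Admissible, TypeI, TypeII, TypeIII, Fin.val_castAdd, Fin.val_natAdd, Fin.lt_def,
    Int.abs_eq_natAbs, gap]
  omega

theorem admissible_natAdd_natAdd (γ : Fin (m + k) → ℕ) (p q : Fin k) (ℓ : ℕ) :
    Admissible m γ (Fin.natAdd m p) (Fin.natAdd m q) ℓ ↔
      p < q ∧ γ (Fin.natAdd m q) + 2 * ℓ ≤ γ (Fin.natAdd m p) := by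
  simp only [Admissible, TypeI, TypeII, TypeIII, Fin.val_natAdd, Fin.lt_def]
  omega

theorem not_admissible_natAdd_castAdd (γ : Fin (m + k) → ℕ) (p : Fin k) (q : Fin m) (ℓ : ℕ) :
    ¬ Admissible m γ (Fin.natAdd m p) (Fin.castAdd k q) ℓ := by
  have hq := q.isLt
  simp only [Admissible, Fin.val_castAdd, Fin.val_natAdd, Fin.lt_def]
  omega

theorem antiBlock_update_castAdd (γ : Fin (m + k) → ℕ) (p : Fin m) (a : ℕ) :
    antiBlock m k (Function.update γ (Fin.castAdd k p) a)
      = Function.update (antiBlock m k γ) p a :=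
  Function.update_comp_eq_of_injective γ (Fin.castAdd_injective m k) p a

theorem symBlock_update_natAdd (γ : Fin (m + k) → ℕ) (p : Fin k) (a : ℕ) :
    symBlock m k (Function.update γ (Fin.natAdd m p) a)
      = Function.update (symBlock m k γ) p a :=
  Function.update_comp_eq_of_injective γ (Fin.natAdd_injective k m) p a

theorem castAdd_ne_natAdd (p : Fin m) (q : Fin k) : Fin.castAdd k p ≠ Fin.natAdd m q := by
  have := p.isLt
  intro h
  have := congrArg Fin.val h
  simp only [Fin.val_castAdd, Fin.val_natAdd] at this
  omega

theorem antiBlock_update_natAdd (γ : Fin (m + k) → ℕ) (p : Fin k) (a : ℕ) :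
    antiBlock m k (Function.update γ (Fin.natAdd m p) a) = antiBlock m k γ := by
  ext q
  exact Function.update_of_ne (castAdd_ne_natAdd q p) _ _

theorem symBlock_update_castAdd (γ : Fin (m + k) → ℕ) (p : Fin m) (a : ℕ) :
    symBlock m k (Function.update γ (Fin.castAdd k p) a) = symBlock m k γ := by
  ext q
  exact Function.update_of_ne (castAdd_ne_natAdd p q).symm _ _

theorem cons_cons_values_update {n : ℕ} (f : Fin n → ℕ) {p q : Fin n} (h : p ≠ q) (a b : ℕ) :
    f p ::ₘ f q ::ₘ values (Function.update (Function.update f p a) q b)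
      = a ::ₘ b ::ₘ values f := by
  have h1 := cons_values_update f p a
  have h2 := cons_values_update (Function.update f p a) q b
  rw [Function.update_of_ne h.symm] at h2
  rw [h2, Multiset.cons_swap, h1, Multiset.cons_swap]

theorem lowers_castAdd_castAdd (Λ Ω : Superpartition m k) (p q : Fin m) (ℓ : ℕ) :
    Lowers Λ Ω (Fin.castAdd k p) (Fin.castAdd k q) ℓ ↔
      p < q ∧ Λ.parts (Fin.castAdd k q) + 2 * ℓ < Λ.parts (Fin.castAdd k p) ∧
      Λ.parts (Fin.castAdd k p) ::ₘ Λ.parts (Fin.castAdd k q) ::ₘ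
        values (antiBlock m k Ω.parts)
        = (Λ.parts (Fin.castAdd k p) - ℓ) ::ₘ (Λ.parts (Fin.castAdd k q) + ℓ) ::ₘ
          values (antiBlock m k Λ.parts) ∧
      values (symBlock m k Ω.parts) = values (symBlock m k Λ.parts) := by
  rw [Lowers, admissible_castAdd_castAdd, and_assoc]
  refine and_congr_right fun hpq => and_congr_right fun hℓ => ?_
  rw [parts_eq_bar_iff, lower, if_pos (by omega), antiBlock_update_castAdd,
    antiBlock_update_castAdd, symBlock_update_castAdd, symBlock_update_castAdd,
    ← cons_cons_values_update (antiBlock m k Λ.parts) hpq.ne]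
  change _ ↔ antiBlock m k Λ.parts p ::ₘ antiBlock m k Λ.parts q ::ₘ _ = _ ∧ _
  rw [Multiset.cons_inj_right, Multiset.cons_inj_right]

theorem lowers_castAdd_natAdd (Λ Ω : Superpartition m k) (p : Fin m) (q : Fin k) (ℓ : ℕ) :
    Lowers Λ Ω (Fin.castAdd k p) (Fin.natAdd m q) ℓ ↔
      ℓ < gap Λ.parts (Fin.castAdd k p) (Fin.natAdd m q) ∧
      Λ.parts (Fin.castAdd k p) ::ₘ values (antiBlock m k Ω.parts)
        = lowFst Λ.parts (Fin.castAdd k p) (Fin.natAdd m q) ℓ ::ₘ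
          values (antiBlock m k Λ.parts) ∧
      Λ.parts (Fin.natAdd m q) ::ₘ values (symBlock m k Ω.parts)
        = lowSnd Λ.parts (Fin.castAdd k p) (Fin.natAdd m q) ℓ ::ₘ
          values (symBlock m k Λ.parts) := by
  rw [Lowers, admissible_castAdd_natAdd]
  refine and_congr_right fun hℓ => ?_
  rw [parts_eq_bar_iff, lower_eq, antiBlock_update_natAdd,
    antiBlock_update_castAdd, symBlock_update_natAdd, symBlock_update_castAdd,
    ← cons_values_update (antiBlock m k Λ.parts) p, ← cons_values_update (symBlock m k Λ.parts) q]
  change _ ↔ antiBlock m k Λ.parts p ::ₘ _ = _ ∧ symBlock m k Λ.parts q ::ₘ _ = _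
  rw [Multiset.cons_inj_right, Multiset.cons_inj_right]

/-- The condition p < q is dropped: for ℓ > 0 it follows from the monotonicity of the symmetric
parts. -/
theorem lowers_natAdd_natAdd (Λ Ω : Superpartition m k) (p q : Fin k) {ℓ : ℕ} (h0 : 0 < ℓ) :
    Lowers Λ Ω (Fin.natAdd m p) (Fin.natAdd m q) ℓ ↔
      Λ.parts (Fin.natAdd m q) + 2 * ℓ ≤ Λ.parts (Fin.natAdd m p) ∧
      values (antiBlock m k Ω.parts) = values (antiBlock m k Λ.parts) ∧
      Λ.parts (Fin.natAdd m p) ::ₘ Λ.parts (Fin.natAdd m q) ::ₘ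
        values (symBlock m k Ω.parts)
        = (Λ.parts (Fin.natAdd m p) - ℓ) ::ₘ (Λ.parts (Fin.natAdd m q) + ℓ) ::ₘ
          values (symBlock m k Λ.parts) := by
  have hpq : Λ.parts (Fin.natAdd m q) + 2 * ℓ ≤ Λ.parts (Fin.natAdd m p) → p < q := by
    intro h
    by_contra hc
    have : Λ.parts (Fin.natAdd m p) ≤ Λ.parts (Fin.natAdd m q) := Λ.antitone (not_lt.1 hc)
    omega
  rw [Lowers, admissible_natAdd_natAdd, and_iff_right_of_imp hpq]
  refine and_congr_right fun hℓ => ?_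
  rw [parts_eq_bar_iff, lower, if_pos (by omega), antiBlock_update_natAdd,
    antiBlock_update_natAdd, symBlock_update_natAdd, symBlock_update_natAdd,
    ← cons_cons_values_update (symBlock m k Λ.parts) (hpq hℓ).ne]
  change _ ↔ _ ∧ symBlock m k Λ.parts p ::ₘ symBlock m k Λ.parts q ::ₘ _ = _
  rw [Multiset.cons_inj_right, Multiset.cons_inj_right]

/-- Two positions in the same block that carry equal parts. -/
def SamePart (Λ : Superpartition m k) (i j : Fin (m + k)) : Prop :=
  Λ.parts i = Λ.parts j ∧ ((i : ℕ) < m ↔ (j : ℕ) < m)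

theorem samePart_castAdd (Λ : Superpartition m k) (p q : Fin m) :
    SamePart Λ (Fin.castAdd k p) (Fin.castAdd k q) ↔ p = q := by
  refine ⟨fun h => Λ.strictAnti.injective h.1, ?_⟩
  rintro rfl
  exact ⟨rfl, Iff.rfl⟩

theorem samePart_natAdd (Λ : Superpartition m k) (p q : Fin k) :
    SamePart Λ (Fin.natAdd m p) (Fin.natAdd m q) ↔
      Λ.parts (Fin.natAdd m p) = Λ.parts (Fin.natAdd m q) := by
  simp [SamePart]

theorem not_samePart_castAdd_natAdd (Λ : Superpartition m k) (p : Fin m) (q : Fin k) :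
    ¬ SamePart Λ (Fin.castAdd k p) (Fin.natAdd m q) := by
  have := p.isLt
  simp [SamePart]

theorem not_samePart_natAdd_castAdd (Λ : Superpartition m k) (p : Fin k) (q : Fin m) :
    ¬ SamePart Λ (Fin.natAdd m p) (Fin.castAdd k q) := by
  have := q.isLt
  simp [SamePart]

/-- The blocks whose multisets change reveal the type: the antisymmetric block only for I, both for
II, the symmetric block only for III. Within a type, the exchange lemmas recover the parts involved
and ℓ; only the choice among equal parts of a block stays free. -/
theorem Lowers.unique {Λ Ω : Superpartition m k} {i j i' j' : Fin (m + k)} {ℓ ℓ' : ℕ}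
    (h : Lowers Λ Ω i j ℓ) (h' : Lowers Λ Ω i' j' ℓ') (h0 : 0 < ℓ) (h0' : 0 < ℓ') :
    SamePart Λ i i' ∧ SamePart Λ j j' ∧ ℓ = ℓ' := by
  have lowNe : ∀ (p : Fin m) (q : Fin k) (l : ℕ), 0 < l →
      l < gap Λ.parts (Fin.castAdd k p) (Fin.natAdd m q) →
      Λ.parts (Fin.castAdd k p) ≠ lowFst Λ.parts (Fin.castAdd k p) (Fin.natAdd m q) l ∧
      Λ.parts (Fin.natAdd m q) ≠ lowSnd Λ.parts (Fin.castAdd k p) (Fin.natAdd m q) l := by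
    intro p q l hl hg
    unfold gap at hg
    unfold lowFst lowSnd
    split_ifs <;> omega
  induction i using Fin.addCases with
  | left p =>
    induction j using Fin.addCases with
    | left q =>
      rw [lowers_castAdd_castAdd] at h
      obtain ⟨-, h1, h2, h3⟩ := h
      induction i' using Fin.addCases with
      | left p' =>
        induction j' using Fin.addCases with
        | left q' =>
          rw [lowers_castAdd_castAdd] at h'
          obtain ⟨-, h1', h2', h3'⟩ := h'
          obtain ⟨e1, e2, e3⟩ := eq_of_cons_cons_exchange h2 h2' (by omega) (by omega) (by omega)
            (by omega) (by omega) (by omega)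
          refine ⟨⟨e1, by simp⟩, ⟨e2, by simp⟩, by omega⟩
        | right q' =>
          rw [lowers_castAdd_natAdd] at h'
          exact absurd h3 (ne_of_cons_exchange h'.2.2 (lowNe _ _ _ h0' h'.1).2)
      | right p' =>
        induction j' using Fin.addCases with
        | left q' => exact absurd h'.1 (not_admissible_natAdd_castAdd _ _ _ _)
        | right q' =>
          rw [lowers_natAdd_natAdd _ _ _ _ h0'] at h'
          exact absurd h'.2.1 (ne_of_cons_cons_exchange h2 (by omega) (by omega))
    | right q =>
      rw [lowers_castAdd_natAdd] at h
      obtain ⟨h1, h2, h3⟩ := h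
      have hne := lowNe _ _ _ h0 h1
      induction i' using Fin.addCases with
      | left p' =>
        induction j' using Fin.addCases with
        | left q' =>
          rw [lowers_castAdd_castAdd] at h'
          exact absurd h'.2.2.2 (ne_of_cons_exchange h3 hne.2)
        | right q' =>
          rw [lowers_castAdd_natAdd] at h'
          obtain ⟨h1', h2', h3'⟩ := h'
          obtain ⟨e1, e2⟩ := eq_of_cons_exchange h2 h2' hne.1
          obtain ⟨e3, e4⟩ := eq_of_cons_exchange h3 h3' hne.2
          refine ⟨⟨e1, by simp⟩, ⟨e3, by simp⟩, ?_⟩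
          unfold lowFst at e2
          unfold gap at h1 h1'
          rw [← e1, ← e3] at e2 h1'
          split_ifs at e2 <;> omega
      | right p' =>
        induction j' using Fin.addCases with
        | left q' => exact absurd h'.1 (not_admissible_natAdd_castAdd _ _ _ _)
        | right q' =>
          rw [lowers_natAdd_natAdd _ _ _ _ h0'] at h'
          exact absurd h'.2.1 (ne_of_cons_exchange h2 hne.1)
  | right p =>
    induction j using Fin.addCases with
    | left q => exact absurd h.1 (not_admissible_natAdd_castAdd _ _ _ _)
    | right q =>
      rw [lowers_natAdd_natAdd _ _ _ _ h0] at h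
      obtain ⟨h1, h2, h3⟩ := h
      induction i' using Fin.addCases with
      | left p' =>
        induction j' using Fin.addCases with
        | left q' =>
          rw [lowers_castAdd_castAdd] at h'
          exact absurd h2 (ne_of_cons_cons_exchange h'.2.2.1 (by omega) (by omega))
        | right q' =>
          rw [lowers_castAdd_natAdd] at h'
          exact absurd h2 (ne_of_cons_exchange h'.2.1 (lowNe _ _ _ h0' h'.1).1)
      | right p' =>
        induction j' using Fin.addCases with
        | left q' => exact absurd h'.1 (not_admissible_natAdd_castAdd _ _ _ _)
        | right q' =>
          rw [lowers_natAdd_natAdd _ _ _ _ h0'] at h'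
          obtain ⟨h1', h2', h3'⟩ := h'
          obtain ⟨e1, e2, e3⟩ := eq_of_cons_cons_exchange h3 h3' (by omega) (by omega) (by omega)
            (by omega) (by omega) (by omega)
          refine ⟨⟨e1, by simp⟩, ⟨e2, by simp⟩, by omega⟩

theorem lowFst_congr {Λ : Superpartition m k} {i j i' j' : Fin (m + k)} (hi : SamePart Λ i i')
    (hj : SamePart Λ j j') (ℓ : ℕ) : lowFst Λ.parts i j ℓ = lowFst Λ.parts i' j' ℓ := by
  unfold lowFst; rw [hi.1, hj.1]

theorem lowSnd_congr {Λ : Superpartition m k} {i j i' j' : Fin (m + k)} (hi : SamePart Λ i i')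
    (hj : SamePart Λ j j') (ℓ : ℕ) : lowSnd Λ.parts i j ℓ = lowSnd Λ.parts i' j' ℓ := by
  unfold lowSnd; rw [hi.1, hj.1]

theorem gap_congr {Λ : Superpartition m k} {i j i' j' : Fin (m + k)} (hi : SamePart Λ i i')
    (hj : SamePart Λ j j') : gap Λ.parts i j = gap Λ.parts i' j' := by
  unfold gap; rw [hi.1, hj.1]

/-- Antisymmetric parts are distinct, so only symmetric positions can really vary. Such a change
alters neither the resulting multisets nor the first block, which alone determines the sign. -/
theorem Lowers.congr {Λ Ω : Superpartition m k} {i j i' j' : Fin (m + k)} {ℓ : ℕ}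
    (h : Lowers Λ Ω i' j' ℓ) (h0 : 0 < ℓ) (hi : SamePart Λ i i') (hj : SamePart Λ j j') :
    Lowers Λ Ω i j ℓ ∧
      antiSign m k (lower Λ.parts i j ℓ) = antiSign m k (lower Λ.parts i' j' ℓ) := by
  have hsign : antiBlock m k (lower Λ.parts i j ℓ) = antiBlock m k (lower Λ.parts i' j' ℓ) →
      antiSign m k (lower Λ.parts i j ℓ) = antiSign m k (lower Λ.parts i' j' ℓ) := by
    intro e
    exact congrArg (fun f => (Equiv.Perm.sign (sortPerm f) : ℤ)) e
  induction i using Fin.addCases with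
  | left p =>
    induction i' using Fin.addCases with
    | right p' => exact absurd hi (not_samePart_castAdd_natAdd _ _ _)
    | left p' =>
      obtain rfl := (samePart_castAdd _ _ _).1 hi
      induction j using Fin.addCases with
      | left q =>
        induction j' using Fin.addCases with
        | right q' => exact absurd hj (not_samePart_castAdd_natAdd _ _ _)
        | left q' =>
          obtain rfl := (samePart_castAdd _ _ _).1 hj
          exact ⟨h, rfl⟩
      | right q =>
        induction j' using Fin.addCases with
        | left q' => exact absurd hj (not_samePart_natAdd_castAdd _ _ _)
        | right q' =>
          refine ⟨?_, hsign ?_⟩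
          · rw [lowers_castAdd_natAdd] at h ⊢
            rw [gap_congr hi hj, lowFst_congr hi hj, lowSnd_congr hi hj, hj.1]
            exact h
          · rw [lower_eq, lower_eq, antiBlock_update_natAdd, antiBlock_update_natAdd,
              lowFst_congr hi hj]
  | right p =>
    induction i' using Fin.addCases with
    | left p' => exact absurd hi (not_samePart_natAdd_castAdd _ _ _)
    | right p' =>
      induction j using Fin.addCases with
      | left q =>
        induction j' using Fin.addCases with
        | left q' => exact absurd h.1 (not_admissible_natAdd_castAdd _ _ _ _)
        | right q' => exact absurd hj (not_samePart_castAdd_natAdd _ _ _)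
      | right q =>
        induction j' using Fin.addCases with
        | left q' => exact absurd hj (not_samePart_natAdd_castAdd _ _ _)
        | right q' =>
          refine ⟨?_, hsign ?_⟩
          · rw [lowers_natAdd_natAdd _ _ _ _ h0] at h ⊢
            rw [hi.1, hj.1]
            exact h
          · rw [lower_eq, lower_eq, antiBlock_update_natAdd, antiBlock_update_natAdd,
              antiBlock_update_natAdd, antiBlock_update_natAdd]

open Classical in
theorem card_samePart_castAdd (Λ : Superpartition m k) (p : Fin m) :
    (Finset.univ.filter fun i => SamePart Λ i (Fin.castAdd k p)).card = 1 := by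
  rw [Finset.card_filter, Fin.sum_univ_add]
  simp [samePart_castAdd, not_samePart_natAdd_castAdd]

open Classical in
theorem card_samePart_natAdd (Λ : Superpartition m k) (p : Fin k) :
    (Finset.univ.filter fun i => SamePart Λ i (Fin.natAdd m p)).card
      = (values (symBlock m k Λ.parts)).count (Λ.parts (Fin.natAdd m p)) := by
  rw [count_values, Finset.card_filter, Fin.sum_univ_add]
  simp only [not_samePart_castAdd_natAdd, if_false, Finset.sum_const_zero, zero_add,
    samePart_natAdd, ← Finset.card_filter]
  congr

end Types

/-! ## Triangularity of the Hamiltonian on monomial symmetric superpolynomials -/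

section Folding

theorem sum_Ioo_fold {A : Type*} [AddCommMonoid A] (d : ℕ) (h : ℕ → A) :
    ∑ ℓ ∈ Finset.Ioo 0 d, h ℓ = ∑ ℓ ∈ Finset.Ioo 0 d,
      (if 2 * ℓ < d then h ℓ + h (d - ℓ) else if 2 * ℓ = d then h ℓ else 0) := by
  have h1 : ∑ ℓ ∈ Finset.Ioo 0 d, (if d < 2 * ℓ then h ℓ else 0)
      = ∑ ℓ ∈ Finset.Ioo 0 d, (if 2 * ℓ < d then h (d - ℓ) else 0) := by
    refine Finset.sum_nbij' (fun ℓ => d - ℓ) (fun ℓ => d - ℓ) ?_ ?_ ?_ ?_ ?_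
    · intro ℓ hℓ; rw [Finset.mem_Ioo] at hℓ ⊢; omega
    · intro ℓ hℓ; rw [Finset.mem_Ioo] at hℓ ⊢; omega
    · intro ℓ hℓ; rw [Finset.mem_Ioo] at hℓ; omega
    · intro ℓ hℓ; rw [Finset.mem_Ioo] at hℓ; omega
    · intro ℓ hℓ
      rw [Finset.mem_Ioo] at hℓ
      have e : d - (d - ℓ) = ℓ := by omega
      rw [e]
      split_ifs <;> first | rfl | omega
  have h2 : ∑ ℓ ∈ Finset.Ioo 0 d, h ℓ
      = ∑ ℓ ∈ Finset.Ioo 0 d, (if 2 * ℓ < d then h ℓ else if 2 * ℓ = d then h ℓ else 0)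
        + ∑ ℓ ∈ Finset.Ioo 0 d, (if d < 2 * ℓ then h ℓ else 0) := by
    rw [← Finset.sum_add_distrib]
    refine Finset.sum_congr rfl fun ℓ _ => ?_
    split_ifs <;> first | omega | simp
  rw [h2, h1, ← Finset.sum_add_distrib]
  refine Finset.sum_congr rfl fun ℓ _ => ?_
  split_ifs <;> simp

/-- This is the symmetry behind the folding: ℓ and the complementary amount give the same two values
in opposite positions. -/
theorem lower_gap_sub {N : ℕ} (γ : Fin N → ℕ) {i j : Fin N} (hij : i ≠ j) {ℓ : ℕ}
    (h : ℓ < gap γ i j) : lower γ i j (gap γ i j - ℓ) = lower γ i j ℓ ∘ Equiv.swap i j := by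
  rw [comp_swap_eq_update _ hij, lower_eq, lower_eq]
  have e1 : lowFst γ i j (gap γ i j - ℓ) = lowSnd γ i j ℓ := by
    unfold gap at h ⊢; unfold lowFst lowSnd; split_ifs <;> omega
  have e2 : lowSnd γ i j (gap γ i j - ℓ) = lowFst γ i j ℓ := by
    unfold gap at h ⊢; unfold lowFst lowSnd; split_ifs <;> omega
  rw [e1, e2]
  ext a
  simp only [Function.update_apply]
  split_ifs <;> simp_all

end Folding

/-! ### Collecting equal terms into the coefficients v_{ΛΩ} -/

section Triangularity

variable {K : Type*} [Field K] {m k : ℕ}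

open Classical in
/-- The coefficient of the rearrangement class of `R_{ij}^{(ℓ)} γ` once the contributions of `ℓ`
and of `|γ_i - γ_j| - ℓ` are combined. -/
def foldCoeff (K : Type*) [Field K] (m : ℕ) {N : ℕ} (γ : Fin N → ℕ) (i j : Fin N) (ℓ : ℕ) : K :=
  ((gap γ i j : K) - delta m i j * ℓ) *
    (if TypeIII m i j ∧ lowFst γ i j ℓ = lowSnd γ i j ℓ then 1 / 2 else 1)

theorem typeI_castAdd (p q : Fin m) : TypeI m (Fin.castAdd k p) (Fin.castAdd k q) :=
  ⟨p.isLt, q.isLt⟩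

theorem not_typeIII_castAdd (p : Fin m) (j : Fin (m + k)) :
    ¬ TypeIII m (Fin.castAdd k p) j := fun h => not_lt.2 h.1 p.isLt

theorem not_typeI_natAdd (i : Fin (m + k)) (q : Fin k) : ¬ TypeI m i (Fin.natAdd m q) :=
  fun h => not_lt.2 (Nat.le_add_right m q) h.2

theorem typeII_castAdd_natAdd (p : Fin m) (q : Fin k) :
    TypeII m (Fin.castAdd k p) (Fin.natAdd m q) := ⟨p.isLt, Nat.le_add_right m q⟩

theorem not_typeII_natAdd (p : Fin k) (j : Fin (m + k)) : ¬ TypeII m (Fin.natAdd m p) j :=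
  fun h => not_lt.2 (Nat.le_add_right m p) h.1

theorem typeIII_natAdd (p q : Fin k) : TypeIII m (Fin.natAdd m p) (Fin.natAdd m q) :=
  ⟨Nat.le_add_right m p, Nat.le_add_right m q⟩

open Classical in
-- This is where δ comes from. Folding gives (d - ℓ) - ℓ = d - 2ℓ for type I and (d - ℓ) + ℓ = d for
-- type III; type II is not folded and keeps d - ℓ. The admissibility bounds select one
-- representative of each folded pair.
theorem sum_lower_eq_sum_admissible [CharZero K] (Λ : Superpartition m k) {i j : Fin (m + k)}
    (hij : i < j) :
    ∑ ℓ ∈ Finset.Ioo 0 (gap Λ.parts i j),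
        ((gap Λ.parts i j : K) - ℓ) • symSum (thetaWord K m k) (lower Λ.parts i j ℓ)
      = ∑ ℓ ∈ Finset.Ioo 0 (gap Λ.parts i j), if Admissible m Λ.parts i j ℓ then
        foldCoeff K m Λ.parts i j ℓ • symSum (thetaWord K m k) (lower Λ.parts i j ℓ) else 0 := by
  induction i using Fin.addCases with
  | left p =>
    induction j using Fin.addCases with
    | left q =>
      have hpq : p < q := hij
      have hlt : Λ.parts (Fin.castAdd k q) < Λ.parts (Fin.castAdd k p) := Λ.strictAnti hpq
      have hgap : gap Λ.parts (Fin.castAdd k p) (Fin.castAdd k q)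
          = Λ.parts (Fin.castAdd k p) - Λ.parts (Fin.castAdd k q) := by unfold gap; omega
      rw [sum_Ioo_fold]
      refine Finset.sum_congr rfl fun ℓ hℓ => ?_
      rw [Finset.mem_Ioo] at hℓ
      rw [admissible_castAdd_castAdd]
      by_cases h1 : 2 * ℓ < gap Λ.parts (Fin.castAdd k p) (Fin.castAdd k q)
      · rw [if_pos h1, if_pos ⟨hpq, by omega⟩, lower_gap_sub _ hij.ne hℓ.2,
          symSum_comp_swap_anti _ hpq.ne, foldCoeff, if_neg fun h => not_typeIII_castAdd _ _ h.1,
          delta, if_pos (typeI_castAdd p q), Nat.cast_sub hℓ.2.le]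
        module
      · rw [if_neg h1, if_neg (c := p < q ∧ _) fun h => h1 (by omega)]
        split_ifs with h2
        -- At the midpoint the two antisymmetric entries coincide, so the term vanishes.
        · have h3 : symSum (thetaWord K m k)
              (lower Λ.parts (Fin.castAdd k p) (Fin.castAdd k q) ℓ) = 0 := by
            refine symSum_eq_zero fun hinj => hpq.ne (hinj ?_)
            rw [lower_eq]
            simp only [antiBlock, Function.update_self, Function.update_of_ne hij.ne]
            unfold lowFst lowSnd
            split_ifs
            omega
          rw [h3, smul_zero]
        · rfl
    | right q =>
      refine Finset.sum_congr rfl fun ℓ hℓ => ?_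
      rw [Finset.mem_Ioo] at hℓ
      rw [admissible_castAdd_natAdd, if_pos hℓ.2, foldCoeff,
        if_neg fun h => not_typeIII_castAdd _ _ h.1, delta, if_neg (not_typeI_natAdd _ _),
        if_pos (typeII_castAdd_natAdd p q)]
      simp
  | right p =>
    induction j using Fin.addCases with
    | left q =>
      have := q.isLt
      simp only [Fin.lt_def, Fin.val_natAdd, Fin.val_castAdd] at hij
      omega
    | right q =>
      have hpq : p < q := by
        rw [Fin.lt_def] at hij ⊢
        simp only [Fin.val_natAdd] at hij
        omega
      have hle : Λ.parts (Fin.natAdd m q) ≤ Λ.parts (Fin.natAdd m p) := Λ.antitone hpq.le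
      have hgap : gap Λ.parts (Fin.natAdd m p) (Fin.natAdd m q)
          = Λ.parts (Fin.natAdd m p) - Λ.parts (Fin.natAdd m q) := by unfold gap; omega
      rw [sum_Ioo_fold]
      refine Finset.sum_congr rfl fun ℓ hℓ => ?_
      rw [Finset.mem_Ioo] at hℓ
      rw [admissible_natAdd_natAdd]
      have hlow : lowFst Λ.parts (Fin.natAdd m p) (Fin.natAdd m q) ℓ
          = lowSnd Λ.parts (Fin.natAdd m p) (Fin.natAdd m q) ℓ ↔
          2 * ℓ = gap Λ.parts (Fin.natAdd m p) (Fin.natAdd m q) := by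
        unfold lowFst lowSnd
        rw [if_pos (by omega), if_pos (by omega)]
        omega
      have hdelta : delta m (Fin.natAdd m p) (Fin.natAdd m q) = 0 := by
        rw [delta, if_neg (not_typeI_natAdd _ _), if_neg (not_typeII_natAdd _ _)]
      rw [foldCoeff, hdelta]
      by_cases h1 : 2 * ℓ < gap Λ.parts (Fin.natAdd m p) (Fin.natAdd m q)
      · rw [if_pos h1, if_pos ⟨hpq, by omega⟩, lower_gap_sub _ hij.ne hℓ.2,
          symSum_comp_swap_sym, if_neg fun h => h1.ne (hlow.1 h.2), Nat.cast_sub hℓ.2.le]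
        push_cast
        module
      · rw [if_neg h1]
        by_cases h2 : 2 * ℓ = gap Λ.parts (Fin.natAdd m p) (Fin.natAdd m q)
        -- The midpoint has no partner: its coefficient d - ℓ is d/2, which accounts for the factor
        -- 1/2 in `foldCoeff`.
        · rw [if_pos h2, if_pos ⟨hpq, by omega⟩, if_pos ⟨typeIII_natAdd p q, hlow.2 h2⟩, ← h2]
          congr 1
          push_cast
          field_simp
          ring
        · rw [if_neg h2, if_neg (by omega)]

theorem lowerCoeff_eq (β : K) (Λ Ω : Superpartition m k) (i j : Fin (m + k)) (ℓ : ℕ) :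
    lowerCoeff β Λ Ω i j ℓ = 2 * β * (antiSign m k (lower Λ.parts i j ℓ) : K) *
      ((gap Λ.parts i j : K) - delta m i j * ℓ) *
      symFactor K Ω i j (lowFst Λ.parts i j ℓ) (lowSnd Λ.parts i j ℓ) := by
  unfold lowerCoeff lowFst lowSnd
  split_ifs with h
  · have : gap Λ.parts i j = Λ.parts i - Λ.parts j := by unfold gap; omega
    rw [this, Nat.cast_sub h.le]
  · have : gap Λ.parts i j = Λ.parts j - Λ.parts i := by unfold gap; omega
    rw [this, Nat.cast_sub (not_lt.1 h)]

open Classical in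
-- This is where n(a,b) comes from: the number of position pairs giving the same lowering is a
-- product of multiplicities in Λ, and the ratio f_Ω/f_Λ converts it into multiplicities in Ω.
theorem card_mul_card_mul_foldCoeff [CharZero K] (β : K) {Λ Ω : Superpartition m k}
    {i j : Fin (m + k)} {ℓ : ℕ} (h : Lowers Λ Ω i j ℓ) (h0 : 0 < ℓ) :
    ((Finset.univ.filter fun a => SamePart Λ a i).card : K) *
      (Finset.univ.filter fun a => SamePart Λ a j).card *
      (2 * β * (foldCoeff K m Λ.parts i j ℓ *
        ((antiSign m k (lower Λ.parts i j ℓ) : K) * fNorm Ω)))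
      = fNorm Λ * lowerCoeff β Λ Ω i j ℓ := by
  suffices key : ((Finset.univ.filter fun a => SamePart Λ a i).card : K) *
      (Finset.univ.filter fun a => SamePart Λ a j).card *
      (if TypeIII m i j ∧ lowFst Λ.parts i j ℓ = lowSnd Λ.parts i j ℓ then 1 / 2 else 1)
        * fNorm Ω
      = fNorm Λ * symFactor K Ω i j (lowFst Λ.parts i j ℓ) (lowSnd Λ.parts i j ℓ) by
    rw [lowerCoeff_eq, foldCoeff]
    linear_combination (2 * β * (antiSign m k (lower Λ.parts i j ℓ) : K) *
      ((gap Λ.parts i j : K) - delta m i j * ℓ)) * key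
  rw [fNorm_eq, fNorm_eq, symFactor, symCount_eq_count, symCount_eq_count]
  induction i using Fin.addCases with
  | left p =>
    induction j using Fin.addCases with
    | left q =>
      rw [lowers_castAdd_castAdd] at h
      rw [if_neg fun h => not_typeIII_castAdd _ _ h.1, if_pos (typeI_castAdd p q),
        card_samePart_castAdd, card_samePart_castAdd, h.2.2.2]
      simp
    | right q =>
      rw [lowers_castAdd_natAdd] at h
      have hne : Λ.parts (Fin.natAdd m q)
          ≠ lowSnd Λ.parts (Fin.castAdd k p) (Fin.natAdd m q) ℓ := by
        have hg := h.1
        unfold gap at hg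
        unfold lowSnd
        split_ifs <;> omega
      have := congrArg (Nat.cast : ℕ → K) (multFactorial_cons_exchange h.2.2 hne)
      rw [Nat.cast_mul, Nat.cast_mul] at this
      rw [if_neg fun h => not_typeIII_castAdd _ _ h.1, if_neg (not_typeI_natAdd _ _),
        if_pos (typeII_castAdd_natAdd p q), card_samePart_castAdd, card_samePart_natAdd]
      push_cast
      linear_combination this
  | right p =>
    induction j using Fin.addCases with
    | left q => exact absurd h.1 (not_admissible_natAdd_castAdd _ _ _ _)
    | right q =>
      rw [lowers_natAdd_natAdd _ _ _ _ h0] at h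
      obtain ⟨h1, -, h2⟩ := h
      have e1 : lowFst Λ.parts (Fin.natAdd m p) (Fin.natAdd m q) ℓ
          = Λ.parts (Fin.natAdd m p) - ℓ := if_pos (by omega)
      have e2 : lowSnd Λ.parts (Fin.natAdd m p) (Fin.natAdd m q) ℓ
          = Λ.parts (Fin.natAdd m q) + ℓ := if_pos (by omega)
      have := congrArg (Nat.cast : ℕ → K) (multFactorial_cons_cons_exchange h2 (by omega)
        (by omega) (by omega))
      rw [← e1, ← e2] at this
      rw [← e1, ← e2] at h2
      rw [if_neg (not_typeI_natAdd _ _), if_neg (not_typeII_natAdd _ _), card_samePart_natAdd,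
        card_samePart_natAdd]
      by_cases hab : lowFst Λ.parts (Fin.natAdd m p) (Fin.natAdd m q) ℓ
          = lowSnd Λ.parts (Fin.natAdd m p) (Fin.natAdd m q) ℓ
      · have hpos : 1 ≤ Multiset.count (lowFst Λ.parts (Fin.natAdd m p) (Fin.natAdd m q) ℓ)
            (values (symBlock m k Ω.parts)) := by
          have hc := congrArg
            (Multiset.count (lowFst Λ.parts (Fin.natAdd m p) (Fin.natAdd m q) ℓ)) h2
          rw [Multiset.count_cons_of_ne (by omega), Multiset.count_cons_of_ne (by omega),
            Multiset.count_cons_self] at hc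
          omega
        rw [if_pos hab, Nat.cast_mul, Nat.cast_mul, Nat.cast_mul, Nat.cast_mul,
          Nat.cast_sub hpos, Nat.cast_one] at this
        rw [if_pos ⟨typeIII_natAdd p q, hab⟩, if_neg (not_not.2 hab)]
        linear_combination (1 / 2) * this
      · rw [if_neg hab, Nat.cast_mul, Nat.cast_mul, Nat.cast_mul, Nat.cast_mul] at this
        rw [if_neg fun h => hab h.2, if_pos hab]
        linear_combination this

open Classical in
-- All triples leading to Ω share ℓ and the parts involved, hence contribute one common value. The
-- sum is that value times the number of position pairs, whichever triple the definition of `vCoeff`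
-- selects.
theorem sum_lowers_eq_vCoeff [CharZero K] (β : K) (Λ Ω : Superpartition m k) :
    ∑ i : Fin (m + k), ∑ j ∈ Finset.Ioi i, ∑ ℓ ∈ Finset.Ioo 0 (gap Λ.parts i j),
        (if Lowers Λ Ω i j ℓ then 2 * β * (foldCoeff K m Λ.parts i j ℓ *
          ((antiSign m k (lower Λ.parts i j ℓ) : K) * fNorm Ω)) else 0)
      = fNorm Λ * vCoeff β Λ Ω := by
  rw [vCoeff]
  split_ifs with h
  · obtain ⟨hpos, hlow⟩ := h.choose_spec
    set t := h.choose
    rw [← card_mul_card_mul_foldCoeff β hlow hpos]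
    generalize hc : (2 * β * (foldCoeff K m Λ.parts t.1 t.2.1 t.2.2 *
        ((antiSign m k (lower Λ.parts t.1 t.2.1 t.2.2) : K) * fNorm Ω))) = c
    have hterm : ∀ i : Fin (m + k), ∑ j ∈ Finset.Ioi i, ∑ ℓ ∈ Finset.Ioo 0 (gap Λ.parts i j),
        (if Lowers Λ Ω i j ℓ then 2 * β * (foldCoeff K m Λ.parts i j ℓ *
          ((antiSign m k (lower Λ.parts i j ℓ) : K) * fNorm Ω)) else 0)
        = ∑ j : Fin (m + k), if SamePart Λ i t.1 ∧ SamePart Λ j t.2.1 then c else 0 := by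
      intro i
      have hval : ∀ j : Fin (m + k), ∀ ℓ ∈ Finset.Ioo 0 (gap Λ.parts i j),
          (if Lowers Λ Ω i j ℓ then 2 * β * (foldCoeff K m Λ.parts i j ℓ *
            ((antiSign m k (lower Λ.parts i j ℓ) : K) * fNorm Ω)) else 0)
          = if (SamePart Λ i t.1 ∧ SamePart Λ j t.2.1) ∧ ℓ = t.2.2 then c else 0 := by
        intro j ℓ hℓ
        rw [Finset.mem_Ioo] at hℓ
        by_cases hL : Lowers Λ Ω i j ℓ
        · obtain ⟨hi, hj, rfl⟩ := hL.unique hlow hℓ.1 hpos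
          rw [if_pos hL, if_pos ⟨⟨hi, hj⟩, rfl⟩, ← hc, (hlow.congr hpos hi hj).2]
          have e1 : delta m i j = delta m t.1 t.2.1 := by
            unfold delta TypeI TypeII
            simp only [hi.2, hj.2, ← not_lt]
          have e2 : TypeIII m i j ↔ TypeIII m t.1 t.2.1 := by
            unfold TypeIII
            simp only [← not_lt, hi.2, hj.2]
          rw [foldCoeff, foldCoeff, gap_congr hi hj, lowFst_congr hi hj, lowSnd_congr hi hj, e1]
          simp only [e2]
        · rw [if_neg hL, if_neg]
          rintro ⟨⟨hi, hj⟩, rfl⟩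
          exact hL (hlow.congr hpos hi hj).1
      rw [Finset.sum_congr rfl fun j _ => Finset.sum_congr rfl (hval j)]
      have hj : ∀ j : Fin (m + k), ∑ ℓ ∈ Finset.Ioo 0 (gap Λ.parts i j),
          (if (SamePart Λ i t.1 ∧ SamePart Λ j t.2.1) ∧ ℓ = t.2.2 then c else 0)
          = if SamePart Λ i t.1 ∧ SamePart Λ j t.2.1 then c else 0 := by
        intro j
        by_cases hs : SamePart Λ i t.1 ∧ SamePart Λ j t.2.1
        · have hmem : t.2.2 ∈ Finset.Ioo 0 (gap Λ.parts i j) := by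
            rw [Finset.mem_Ioo, gap_congr hs.1 hs.2]
            exact ⟨hpos, hlow.1.lt_gap hpos⟩
          simp only [hs, and_self, true_and, if_true, Finset.sum_ite_eq', hmem]
        · simp only [hs, false_and, if_false, Finset.sum_const_zero]
      rw [Finset.sum_congr rfl fun j _ => hj j]
      refine Finset.sum_subset (Finset.subset_univ _) fun j _ hj' => if_neg ?_
      rintro ⟨hi, hj⟩
      exact hj' (Finset.mem_Ioi.2 (hlow.congr hpos hi hj).1.1.1)
    rw [Finset.sum_congr rfl fun i _ => hterm i]
    simp only [ite_and, Finset.sum_ite_irrel, Finset.sum_const_zero]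
    simp only [← Finset.sum_filter, Finset.sum_const, nsmul_eq_mul]
    ring
  · rw [mul_zero]
    refine Finset.sum_eq_zero fun i _ => Finset.sum_eq_zero fun j _ =>
      Finset.sum_eq_zero fun ℓ hℓ => if_neg fun hL => h ⟨(i, j, ℓ), ?_, hL⟩
    exact (Finset.mem_Ioo.1 hℓ).1

open Classical in
-- At most one summand is nonzero: a lowering has a single rearrangement, and none when two
-- antisymmetric entries collide, in which case the left side vanishes too.
theorem symSum_lower_eq_sum [CharZero K] {Λ : Superpartition m k} {T : Finset (Superpartition m k)}
    {i j : Fin (m + k)} {ℓ : ℕ} (hT : ∀ Ω, Lowers Λ Ω i j ℓ → Ω ∈ T)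
    (hadm : Admissible m Λ.parts i j ℓ) :
    symSum (thetaWord K m k) (lower Λ.parts i j ℓ) = ∑ Ω ∈ T, if Lowers Λ Ω i j ℓ then
      ((antiSign m k (lower Λ.parts i j ℓ) : K) * fNorm Ω) • mono K Ω else 0 := by
  by_cases hinj : Function.Injective (antiBlock m k (lower Λ.parts i j ℓ))
  · obtain ⟨Ω, hΩ⟩ := exists_parts_eq_bar hinj
    have hL : Lowers Λ Ω i j ℓ := ⟨hadm, hΩ⟩
    rw [Finset.sum_eq_single_of_mem Ω (hT Ω hL), if_pos hL, symSum_bar, ← hΩ,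
      symSum_eq_smul_mono, smul_smul]
    intro Ω' _ hne
    refine if_neg fun h => hne ?_
    ext1
    rw [h.2, hΩ]
  · rw [symSum_eq_zero hinj, Finset.sum_eq_zero]
    intro Ω _
    exact if_neg fun h => hinj (injective_of_parts_eq_bar h.2)

/-- `T` is any finite set containing the proper lowerings; additional members do no harm because
their coefficient is zero. Uniqueness uses the lowerings themselves, the determinant the earlier
members of the list. -/
theorem hamiltonian_mono [CharZero K] (β : K) (Λ : Superpartition m k)
    (T : Finset (Superpartition m k))
    (hT : ∀ Ω i j ℓ, 0 < ℓ → Lowers Λ Ω i j ℓ → Ω ∈ T) :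
    hamiltonian β (mono K Λ) = toRat (eigenvalue β Λ • mono K Λ
      + ∑ Ω ∈ T, vCoeff β Λ Ω • mono K Ω) := by
  classical
  have h1 : ∑ i : Fin (m + k), ∑ j ∈ Finset.Ioi i, ∑ ℓ ∈ Finset.Ioo 0 (gap Λ.parts i j),
        ((gap Λ.parts i j : K) - ℓ) • symSum (thetaWord K m k) (lower Λ.parts i j ℓ)
      = ∑ i : Fin (m + k), ∑ j ∈ Finset.Ioi i, ∑ ℓ ∈ Finset.Ioo 0 (gap Λ.parts i j), ∑ Ω ∈ T,
        (if Lowers Λ Ω i j ℓ then (foldCoeff K m Λ.parts i j ℓ *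
          ((antiSign m k (lower Λ.parts i j ℓ) : K) * fNorm Ω)) else 0) • mono K Ω := by
    refine Finset.sum_congr rfl fun i _ => Finset.sum_congr rfl fun j hj => ?_
    rw [sum_lower_eq_sum_admissible Λ (Finset.mem_Ioi.1 hj)]
    refine Finset.sum_congr rfl fun ℓ hℓ => ?_
    by_cases hadm : Admissible m Λ.parts i j ℓ
    · rw [if_pos hadm, symSum_lower_eq_sum (fun Ω => hT Ω i j ℓ (Finset.mem_Ioo.1 hℓ).1) hadm,
        Finset.smul_sum]
      refine Finset.sum_congr rfl fun Ω _ => ?_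
      split_ifs
      · rw [smul_smul]
      · rw [smul_zero, zero_smul]
    · rw [if_neg hadm, Finset.sum_eq_zero]
      intro Ω _
      rw [if_neg fun h => hadm h.1, zero_smul]
  have h2 : (2 * β) • ∑ i : Fin (m + k), ∑ j ∈ Finset.Ioi i,
        ∑ ℓ ∈ Finset.Ioo 0 (gap Λ.parts i j),
        ((gap Λ.parts i j : K) - ℓ) • symSum (thetaWord K m k) (lower Λ.parts i j ℓ)
      = ∑ Ω ∈ T, ((fNorm Λ : K) * vCoeff β Λ Ω) • mono K Ω := by
    rw [h1]
    have hcomm : ∀ F : Fin (m + k) → Fin (m + k) → ℕ → Superpartition m k →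
        SuperPoly K (m + k),
        ∑ i : Fin (m + k), ∑ j ∈ Finset.Ioi i, ∑ ℓ ∈ Finset.Ioo 0 (gap Λ.parts i j),
          ∑ Ω ∈ T, F i j ℓ Ω
        = ∑ Ω ∈ T, ∑ i : Fin (m + k), ∑ j ∈ Finset.Ioi i,
          ∑ ℓ ∈ Finset.Ioo 0 (gap Λ.parts i j), F i j ℓ Ω := by
      intro F
      rw [Finset.sum_comm (s := T)]
      refine Finset.sum_congr rfl fun i _ => ?_
      rw [Finset.sum_comm (s := T)]
      exact Finset.sum_congr rfl fun j _ => Finset.sum_comm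
    rw [hcomm, Finset.smul_sum]
    refine Finset.sum_congr rfl fun Ω _ => ?_
    rw [← sum_lowers_eq_vCoeff]
    simp only [← Finset.sum_smul, smul_smul, Finset.mul_sum, mul_ite, mul_zero]
  rw [mono_eq, hamiltonian_smul, hamiltonian_symSum, h2, ← map_smul, ← eigenvalue_eq_diagCoeff]
  congr 1
  rw [smul_add, smul_comm, Finset.smul_sum]
  congr 1
  refine Finset.sum_congr rfl fun Ω _ => ?_
  rw [smul_smul, inv_mul_cancel_left₀ (fNorm_ne_zero K Λ)]

end Triangularity

/-! ## Uniqueness of Jack superpolynomials -/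

section Uniqueness

variable {K : Type*} [Field K] {m k : ℕ}

theorem parts_injective : Function.Injective (Superpartition.parts (m := m) (k := k)) :=
  fun _ _ h => Superpartition.ext h

theorem finite_setOf_lowers (Λ : Superpartition m k) :
    {Ω : Superpartition m k | ∃ i j ℓ, 0 < ℓ ∧ Lowers Λ Ω i j ℓ}.Finite := by
  refine ((Set.finite_Iic fun _ : Fin (m + k) => ∑ l, Λ.parts l).preimage
    (f := Superpartition.parts) parts_injective.injOn).subset ?_
  rintro Ω ⟨i, j, ℓ, -, h⟩ l
  have hs := (SLE.sum_eq_and_excess_le (Relation.ReflTransGen.single ⟨i, j, ℓ, h⟩ : SLE Ω Λ)).1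
  rw [← hs]
  exact Finset.single_le_sum (fun _ _ => Nat.zero_le _) (Finset.mem_univ l)

/-- The superpartitions obtained from `Λ` by a single non-trivial lowering operator. -/
def lowerings (Λ : Superpartition m k) : Finset (Superpartition m k) :=
  (finite_setOf_lowers Λ).toFinset

theorem hamiltonian_mono_lowerings [CharZero K] (β : K) (Λ : Superpartition m k) :
    hamiltonian β (mono K Λ) = toRat (eigenvalue β Λ • mono K Λ
      + ∑ Ω ∈ lowerings Λ, vCoeff β Λ Ω • mono K Ω) :=
  hamiltonian_mono β Λ _ fun Ω i j ℓ h0 h => by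
    rw [lowerings, Set.Finite.mem_toFinset]; exact ⟨i, j, ℓ, h0, h⟩

theorem sumSq_lt_of_mem_lowerings {Λ Ω : Superpartition m k} (h : Ω ∈ lowerings Λ) :
    sumSq Ω < sumSq Λ := by
  rw [lowerings, Set.Finite.mem_toFinset] at h
  obtain ⟨i, j, ℓ, h0, h⟩ := h
  exact h.sumSq_lt h0

/-- Choose Ω in the support with the largest sum of squares. No lowering of a support element equals
Ω, so the coefficient of m_Ω sees only the diagonal term and forces its eigenvalue to be `e`. -/
theorem eq_zero_of_hamiltonian_eq [CharZero K] {β e : K} {d : Superpartition m k →₀ K}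
    (hd : ∀ Ω ∈ d.support, eigenvalue β Ω ≠ e)
    (h : hamiltonian β (Finsupp.linearCombination K (mono K) d)
      = e • toRat (Finsupp.linearCombination K (mono K) d)) : d = 0 := by
  by_contra hne
  obtain ⟨Ω, hΩ, hmax⟩ := Finset.exists_max_image d.support sumSq
    (Finsupp.support_nonempty_iff.2 hne)
  have h1 : hamiltonianLin β (Finsupp.linearCombination K (mono K) d)
      = toRat (∑ Γ ∈ d.support, d Γ • (eigenvalue β Γ • mono K Γ
        + ∑ Ω ∈ lowerings Γ, vCoeff β Γ Ω • mono K Ω)) := by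
    rw [Finsupp.linearCombination_apply, Finsupp.sum, map_sum, map_sum]
    refine Finset.sum_congr rfl fun Γ _ => ?_
    rw [map_smul, map_smul]
    congr 1
    exact hamiltonian_mono_lowerings β Γ
  have h2 := h1.symm.trans h
  rw [← map_smul] at h2
  have h3 := congrArg (termCoeff K m k Ω.parts) (toRat_injective h2)
  rw [Finsupp.linearCombination_apply, Finsupp.sum, map_smul, map_sum, map_sum] at h3
  have hdiag : ∀ Γ ∈ d.support, Γ ≠ Ω → termCoeff K m k Ω.parts (d Γ • mono K Γ) = 0 := by
    intro Γ _ hΓ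
    rw [map_smul, termCoeff_mono_of_ne hΓ, smul_zero]
  have hlow : ∀ Γ ∈ d.support, termCoeff K m k Ω.parts
      (∑ Δ ∈ lowerings Γ, vCoeff β Γ Δ • mono K Δ) = 0 := by
    intro Γ hΓ
    rw [map_sum]
    refine Finset.sum_eq_zero fun Δ hΔ => ?_
    have hlt := (sumSq_lt_of_mem_lowerings hΔ).trans_le (hmax Γ hΓ)
    rw [map_smul, termCoeff_mono_of_ne, smul_zero]
    rintro rfl
    exact lt_irrefl _ hlt
  rw [Finset.sum_eq_single_of_mem Ω hΩ, Finset.sum_eq_single_of_mem Ω hΩ hdiag] at h3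
  · rw [map_smul, map_add, hlow Ω hΩ, add_zero, map_smul, map_smul] at h3
    simp only [smul_eq_mul] at h3
    have hd0 : d Ω ≠ 0 := Finsupp.mem_support_iff.1 hΩ
    have ht := termCoeff_mono_self (K := K) Ω
    refine hd Ω hΩ (mul_right_cancel₀ (mul_ne_zero hd0 ht) ?_)
    linear_combination h3
  · intro Γ hΓ hne'
    rw [map_smul, map_add, hlow Γ hΓ, map_smul, termCoeff_mono_of_ne hne', smul_zero, add_zero,
      smul_zero]

theorem IsJack.unique [CharZero K] {β : K} (hβ : ∀ q : ℚ, q < 0 → β ≠ (q : K))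
    {Λ : Superpartition m k} {J J' : SuperPoly K (m + k)} (h : IsJack β Λ J)
    (h' : IsJack β Λ J') : J = J' := by
  classical
  obtain ⟨h1, c, hc, h2⟩ := h
  obtain ⟨h1', c', hc', h2'⟩ := h'
  have hJ : J = Finsupp.linearCombination K (mono K) (c - c') + J' := by
    have hcc : c = (c - c') + c' := (sub_add_cancel c c').symm
    have e : Finsupp.linearCombination K (mono K) c
        = Finsupp.linearCombination K (mono K) (c - c')
          + Finsupp.linearCombination K (mono K) c' := by
      rw [← map_add, ← hcc]
    rw [h2, h2']
    change mono K Λ + Finsupp.linearCombination K (mono K) c = _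
    rw [e]
    exact add_left_comm _ _ _
  have hd : c - c' = 0 := by
    refine eq_zero_of_hamiltonian_eq (β := β) (e := eigenvalue β Λ) (fun Ω hΩ => ?_) ?_
    · refine eigenvalue_ne_of_domLT hβ ?_
      rcases Finset.mem_union.1 (Finsupp.support_sub hΩ) with hm | hm
      · exact hc Ω hm
      · exact hc' Ω hm
    · rw [hJ, hamiltonian_add, map_add, smul_add, h1'] at h1
      exact add_right_cancel h1
  rw [hJ, hd, map_zero, zero_add]

theorem IsStrongJack.isJack {β : K} {Λ : Superpartition m k} {J : SuperPoly K (m + k)}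
    (h : IsStrongJack β Λ J) : IsJack β Λ J := by
  obtain ⟨h1, c, hc, h2⟩ := h
  exact ⟨h1, c, fun Ω hΩ => (hc Ω hΩ).domLT, h2⟩

end Uniqueness

/-! ## The determinantal formula -/

section Determinant

/-- The signed maximal minors of a matrix with one more column than rows. -/
def signedMinor {K : Type*} [Field K] {n : ℕ} (M : Matrix (Fin n) (Fin (n + 1)) K)
    (j : Fin (n + 1)) : K := (-1) ^ (j : ℕ) * (M.submatrix id j.succAbove).det

/-- Placing row r on top of M gives a square matrix with a repeated row; expand its zero determinant
along the top. -/
theorem sum_mul_signedMinor {K : Type*} [Field K] {n : ℕ} (M : Matrix (Fin n) (Fin (n + 1)) K)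
    (r : Fin n) : ∑ j, M r j * signedMinor M j = 0 := by
  let A : Matrix (Fin (n + 1)) (Fin (n + 1)) K := Matrix.of (Fin.cons (M r) M)
  have h0 : A.det = 0 := Matrix.det_zero_of_row_eq (Fin.succ_ne_zero r).symm rfl
  rw [Matrix.det_succ_row_zero] at h0
  rw [← h0]
  refine Finset.sum_congr rfl fun j _ => ?_
  have e1 : A 0 j = M r j := rfl
  have e2 : A.submatrix Fin.succ j.succAbove = M.submatrix id j.succAbove := rfl
  rw [e1, e2, signedMinor]
  ring

variable {K : Type*} [Field K] {m k n : ℕ}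

/-- Deleting the last column leaves an upper triangular matrix with the eigenvalue differences on
its diagonal. -/
theorem signedMinor_last_scalarRows (β : K) (L : Fin (n + 1) → Superpartition m k) :
    signedMinor (scalarRows β L) (Fin.last n)
      = (-1) ^ n * ∏ i : Fin n, (eigenvalue β (L i.castSucc) - eigenvalue β (L (Fin.last n))) := by
  rw [signedMinor, Fin.val_last, Matrix.det_of_isUpperTriangular]
  · congr 1
    refine Finset.prod_congr rfl fun i _ => ?_
    simp [scalarRows]
  · intro i j hij
    have : j.castSucc < i.castSucc := Fin.castSucc_lt_castSucc_iff.2 hij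
    simp [scalarRows, this]

theorem sum_scalarRows_mul (β : K) (L : Fin (n + 1) → Superpartition m k) (r : Fin n)
    (x : Fin (n + 1) → K) : ∑ j, scalarRows β L r j * x j
      = (eigenvalue β (L r.castSucc) - eigenvalue β (L (Fin.last n))) * x r.castSucc
        + ∑ j ∈ Finset.Ioi r.castSucc, vCoeff β (L j) (L r.castSucc) * x j := by
  have h : ∀ j, scalarRows β L r j * x j
      = (if j = r.castSucc then
          (eigenvalue β (L r.castSucc) - eigenvalue β (L (Fin.last n))) * x r.castSucc else 0)
        + if j ∈ Finset.Ioi r.castSucc then vCoeff β (L j) (L r.castSucc) * x j else 0 := by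
    intro j
    rw [scalarRows, Matrix.of_apply]
    rcases lt_trichotomy j r.castSucc with hj | hj | hj
    · rw [if_pos hj, if_neg hj.ne, if_neg fun h => lt_asymm hj (Finset.mem_Ioi.1 h)]
      simp
    · subst hj
      simp
    · rw [if_neg (lt_asymm hj), if_neg hj.ne', if_neg hj.ne', if_pos (Finset.mem_Ioi.2 hj)]
      simp
  rw [Finset.sum_congr rfl fun j _ => h j, Finset.sum_add_distrib, Finset.sum_ite_eq',
    if_pos (Finset.mem_univ _), Finset.sum_ite_mem, Finset.univ_inter]

/-- Every lowering of a listed superpartition is again below Λ, hence listed, and by compatibility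
not later; the drop in the sum of squares makes it strictly earlier. -/
theorem IsLinearExtension.hamiltonian_mono [CharZero K] {Λ : Superpartition m k}
    {L : Fin (n + 1) → Superpartition m k} (hL : IsLinearExtension Λ L) (β : K)
    (j : Fin (n + 1)) : hamiltonian β (mono K (L j)) = toRat (eigenvalue β (L j) • mono K (L j)
      + ∑ r ∈ Finset.Iio j, vCoeff β (L j) (L r) • mono K (L r)) := by
  classical
  rw [JackSuper.hamiltonian_mono β (L j) ((Finset.Iio j).image L),
    Finset.sum_image hL.injective.injOn]
  intro Ω a b ℓ h0 h
  have h1 : SLE Ω (L j) := Relation.ReflTransGen.single ⟨a, b, ℓ, h⟩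
  have h2 : SLE (L j) Λ := (hL.mem_range_iff _).1 ⟨j, rfl⟩
  obtain ⟨r, rfl⟩ := (hL.mem_range_iff Ω).2 (h2.trans h1)
  refine Finset.mem_image_of_mem L (Finset.mem_Iio.2 (lt_of_le_of_ne (hL.compatible r j h1) ?_))
  rintro rfl
  exact lt_irrefl _ (h.sumSq_lt h0)

theorem IsLinearExtension.slt {Λ : Superpartition m k}
    {L : Fin (n + 1) → Superpartition m k} (hL : IsLinearExtension Λ L) (i : Fin n) :
    SLT (L i.castSucc) Λ := by
  refine ⟨(hL.mem_range_iff _).1 ⟨_, rfl⟩, fun e => ?_⟩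
  rw [← hL.last] at e
  exact (Fin.castSucc_lt_last i).ne (hL.injective e)

theorem IsLinearExtension.hamiltonian_sum [CharZero K] {Λ : Superpartition m k}
    {L : Fin (n + 1) → Superpartition m k} (hL : IsLinearExtension Λ L) (β : K) :
    hamiltonian β (∑ j, signedMinor (scalarRows β L) j • mono K (L j))
      = eigenvalue β Λ • toRat (∑ j, signedMinor (scalarRows β L) j • mono K (L j)) := by
  have h1 : hamiltonianLin β (∑ j, signedMinor (scalarRows β L) j • mono K (L j))
      = toRat (∑ j, signedMinor (scalarRows β L) j • (eigenvalue β (L j) • mono K (L j)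
      + ∑ r ∈ Finset.Iio j, vCoeff β (L j) (L r) • mono K (L r))) := by
    rw [map_sum, map_sum]
    refine Finset.sum_congr rfl fun j _ => ?_
    rw [map_smul, map_smul]
    congr 1
    exact hL.hamiltonian_mono β j
  refine h1.trans ?_
  rw [← map_smul]
  congr 1
  have hswap : ∑ j, ∑ r ∈ Finset.Iio j,
      signedMinor (scalarRows β L) j • vCoeff β (L j) (L r) • mono K (L r)
      = ∑ r, ∑ j ∈ Finset.Ioi r,
        signedMinor (scalarRows β L) j • vCoeff β (L j) (L r) • mono K (L r) :=
    Finset.sum_comm' (by simp)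
  simp only [smul_add, Finset.sum_add_distrib, Finset.smul_sum]
  rw [hswap, ← Finset.sum_add_distrib]
  refine Finset.sum_congr rfl fun r _ => ?_
  simp only [smul_smul]
  rw [← Finset.sum_smul, ← add_smul]
  congr 1
  rw [← hL.last]
  -- At the last monomial only the diagonal term ε_Λ is present. At any other, the required identity
  -- is the orthogonality of the minors to row r.
  induction r using Fin.lastCases with
  | last =>
    have : Finset.Ioi (Fin.last n) = ∅ := by
      ext a; simp [Fin.le_last]
    rw [this, Finset.sum_empty, add_zero, mul_comm]
  | cast r =>
    have h2 := sum_mul_signedMinor (scalarRows β L) r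
    rw [sum_scalarRows_mul] at h2
    simp only [mul_comm (signedMinor _ _) (vCoeff _ _ _)]
    linear_combination h2

theorem detFormula_eq (β : K) (L : Fin (n + 1) → Superpartition m k) :
    detFormula β L = ((-1) ^ n * ∏ i : Fin n,
      1 / (eigenvalue β (L i.castSucc) - eigenvalue β (L (Fin.last n)))) •
        ∑ j, signedMinor (scalarRows β L) j • mono K (L j) := rfl

theorem IsLinearExtension.isStrongJack_detFormula [CharZero K] {Λ : Superpartition m k}
    {L : Fin (n + 1) → Superpartition m k} (hL : IsLinearExtension Λ L) {β : K}
    (hne : ∀ i : Fin n, eigenvalue β (L i.castSucc) ≠ eigenvalue β Λ) :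
    IsStrongJack β Λ (detFormula β L) := by
  classical
  rw [detFormula_eq]
  refine ⟨by rw [hamiltonian_smul, hL.hamiltonian_sum, map_smul, smul_comm], ?_⟩
  generalize hc : ((-1) ^ n * ∏ i : Fin n,
      1 / (eigenvalue β (L i.castSucc) - eigenvalue β (L (Fin.last n)))) = c
  -- The prefactor inverts the last minor, including its sign (-1)ⁿ, so m_Λ has coefficient 1.
  have hlast : c * signedMinor (scalarRows β L) (Fin.last n) = 1 := by
    rw [signedMinor_last_scalarRows, ← hc, mul_mul_mul_comm, ← mul_pow, ← Finset.prod_mul_distrib]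
    rw [Finset.prod_eq_one]
    · simp
    · intro i _
      refine one_div_mul_cancel (sub_ne_zero.2 ?_)
      rw [hL.last]
      exact hne i
  refine ⟨∑ i : Fin n, Finsupp.single (L i.castSucc)
    (c * signedMinor (scalarRows β L) i.castSucc), fun Ω hΩ => ?_, ?_⟩
  · by_contra hcon
    refine Finsupp.mem_support_iff.1 hΩ ?_
    rw [Finsupp.finsetSum_apply]
    refine Finset.sum_eq_zero fun i _ => Finsupp.single_eq_of_ne ?_
    rintro rfl
    exact hcon (hL.slt i)
  · rw [← Finsupp.linearCombination_apply, map_sum, Fin.sum_univ_castSucc, smul_add, smul_smul,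
      hlast, one_smul, hL.last, Finset.smul_sum]
    refine (add_comm _ _).trans ?_
    congr 1
    refine Finset.sum_congr rfl fun i _ => ?_
    rw [Finsupp.linearCombination_single, smul_smul]

end Determinant

end JackSuper

end

theorem theorem11 {K : Type*} [Field K] [CharZero K] (β : K)
    (hβ : ∀ q : ℚ, q < 0 → β ≠ (q : K)) {m k n : ℕ}
    (Λ : JackSuper.Superpartition m k) (L : Fin (n + 1) → JackSuper.Superpartition m k)
    (hL : JackSuper.IsLinearExtension Λ L) :
    (∀ i : Fin n, JackSuper.eigenvalue β (L i.castSucc) ≠ JackSuper.eigenvalue β Λ) ∧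
    (∀ J : JackSuper.SuperPoly K (m + k),
      JackSuper.IsJack β Λ J ↔ J = JackSuper.detFormula β L) ∧
    (∀ J : JackSuper.SuperPoly K (m + k),
      JackSuper.IsStrongJack β Λ J ↔ J = JackSuper.detFormula β L) := by
  have hne : ∀ i : Fin n,
      JackSuper.eigenvalue β (L i.castSucc) ≠ JackSuper.eigenvalue β Λ := fun i =>
    JackSuper.eigenvalue_ne_of_domLT hβ (hL.slt i).domLT
  have hS := hL.isStrongJack_detFormula hne
  -- Existence holds under the stronger triangularity and uniqueness under the weaker one, so both
  -- characterisations single out the same element.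
  refine ⟨hne, fun J => ⟨fun hJ => hJ.unique hβ hS.isJack, ?_⟩,
    fun J => ⟨fun hJ => hJ.isJack.unique hβ hS.isJack, ?_⟩⟩
  · rintro rfl; exact hS.isJack
  · rintro rfl; exact hS
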